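/- Let $P=(P_{ij})\in[0,1]^{k\times k}$ be a symmetric matrix, let $W$ be the weighted graph on $\{1,\dots,k\}$ with edge weights $P_{ij}$ (loops allowed), let $c_i=\sum_j P_{ji}$ be its column sums, $c_{\min}=\min_i c_i$ and $\mathrm{vol}(W)=\sum_i c_i$. For $t\ge 1$ let $G=G_t$ be the $t$-th order stochastic Kronecker graph generated by $P$: its vertices are the words of length $t$ over $\{1,\dots,k\}$, and each edge $\{u,v\}$ is present independently with probability $\prod_{i=1}^t P_{u_iv_i}$. The signature $\sigma(v)=(\sigma_1(v),\dots,\sigma_k(v))$ of a vertex $v$ records the proportion $\sigma_i(v)$ of the symbols of $v$ that are equal to $i$. Assume that $W$ (its edges being the pairs, loops included, with $P_{ij}>0$) is connected and non-bipartite and that $\sum_i c_i\ln c_i>0$. Let $\pi$ be the stationary distribution of the random walk on $W$, which has transition probabilities $P_{ij}/c_i$. Fix $\epsilon>0$ with $\epsilon\ne 1$, and suppose that \[ \epsilon<\frac{\sum_i c_i\ln c_i}{\sum_i c_i\ln c_i-\mathrm{vol}(W)\ln c_{\min}}\quad\text{if } \sum_i c_i\ln c_i\neq \mathrm{vol}(W)\ln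 c_{\min} \] (with no upper bound on $\epsilon$ if $\sum_i c_i\ln c_i=\mathrm{vol}(W)\ln c_{\min}$). Let \[ S_\epsilon=S_\epsilon(t)=\{v\in V(G): \sigma_i(v)>(1-\epsilon)\pi_i \text{ for all } i\}, \] and let $H$ be the subgraph of $G$ induced on $S_\epsilon$. Then there are constants $d>1$, $a>0$ and $K>0$, depending only on $P$ and $\epsilon$, such that for all sufficiently large $t$, with probability at least $1-e^{-a d^t}$, the graph $H$ is connected and has diameter at most $K\ln|S_\epsilon|$. -/

import Mathlib

open MeasureTheory Filter
open scoped Matrix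

noncomputable section

namespace Kronecker

/-- The column sum `c_j` of the generating matrix `P`, i.e. the (weighted) degree of the vertex `j`
of the weighted graph `W` on `{1, ..., k}` whose weights are the entries of `P`. -/
def colSum {k : ℕ} (P : Matrix (Fin k) (Fin k) ℝ) (j : Fin k) : ℝ :=
  ∑ i, P i j

/-- The volume of `W`: the sum of all degrees. -/
def vol {k : ℕ} (P : Matrix (Fin k) (Fin k) ℝ) : ℝ :=
  ∑ i, colSum P i

/-- The smallest column sum of `P` (a minimum, as the index set is finite). -/
def minColSum {k : ℕ} (P : Matrix (Fin k) (Fin k) ℝ) : ℝ :=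
  ⨅ i, colSum P i

/-- The sum `∑ i, c_i ln c_i` over the column sums of `P`. -/
def sumDegLogDeg {k : ℕ} (P : Matrix (Fin k) (Fin k) ℝ) : ℝ :=
  ∑ i, colSum P i * Real.log (colSum P i)

/-- The graph formed by the edges of positive weight of `W` between distinct vertices; loops play
no role in connectivity. -/
def supportGraph {k : ℕ} (P : Matrix (Fin k) (Fin k) ℝ) : SimpleGraph (Fin k) :=
  SimpleGraph.fromRel (fun i j => 0 < P i j)

/-- `W` is connected. -/
def WConnected {k : ℕ} (P : Matrix (Fin k) (Fin k) ℝ) : Prop :=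
  (supportGraph P).Connected

/-- `W` is bipartite: its vertices can be split into two classes such that every edge of positive
weight, loops included, joins the two classes. In particular a graph with a loop is not
bipartite. -/
def WBipartite {k : ℕ} (P : Matrix (Fin k) (Fin k) ℝ) : Prop :=
  ∃ side : Fin k → Bool, ∀ i j, 0 < P i j → side i ≠ side j

/-- The transition matrix `M = C⁻¹ P` of the random walk on `W`, where `C` is the diagonal matrix
of the column sums: `M i j = P i j / c_i`. -/
def walkMatrix {k : ℕ} (P : Matrix (Fin k) (Fin k) ℝ) : Matrix (Fin k) (Fin k) ℝ :=
  Matrix.of fun i j => P i j / colSum P i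

/-- `π` is a stationary distribution of the transition matrix `M`: a probability (row) vector
with `π M = π`. -/
def IsStationary {k : ℕ} (M : Matrix (Fin k) (Fin k) ℝ) (π : Fin k → ℝ) : Prop :=
  (∀ i, 0 ≤ π i) ∧ ∑ i, π i = 1 ∧ π ᵥ* M = π

/-- The entry `∏ i, P (u i) (v i)` of the `t`-fold Kronecker power of `P` at the words `u`, `v` of
length `t`. -/
def kronPow {k : ℕ} (P : Matrix (Fin k) (Fin k) ℝ) (t : ℕ) :
    Matrix (Fin t → Fin k) (Fin t → Fin k) ℝ :=
  Matrix.of fun u v => ∏ i, P (u i) (v i)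

theorem kronPow_comm {k : ℕ} {P : Matrix (Fin k) (Fin k) ℝ} (hP : P.IsSymm) (t : ℕ)
    (u v : Fin t → Fin k) : kronPow P t u v = kronPow P t v u := by
  simp only [kronPow, Matrix.of_apply]
  exact Finset.prod_congr rfl fun i _ => hP.apply (v i) (u i)

theorem kronPow_mem {k : ℕ} {P : Matrix (Fin k) (Fin k) ℝ}
    (h01 : ∀ i j, P i j ∈ Set.Icc (0 : ℝ) 1) (t : ℕ) (u v : Fin t → Fin k) :
    kronPow P t u v ∈ Set.Icc (0 : ℝ) 1 := by
  simp only [kronPow, Matrix.of_apply]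
  exact ⟨Finset.prod_nonneg fun i _ => (h01 (u i) (v i)).1,
    Finset.prod_le_one (fun i _ => (h01 (u i) (v i)).1) fun i _ => (h01 (u i) (v i)).2⟩

/-- The probability of the edge `{u, v}`. -/
def edgeProb {k : ℕ} (P : Matrix (Fin k) (Fin k) ℝ) (hP : P.IsSymm)
    (h01 : ∀ i j, P i j ∈ Set.Icc (0 : ℝ) 1) (t : ℕ) : Sym2 (Fin t → Fin k) → unitInterval :=
  Sym2.lift ⟨fun u v => ⟨kronPow P t u v, kronPow_mem h01 t u v⟩,
    fun u v => Subtype.ext (kronPow_comm hP t u v)⟩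

/-- The law of the `t`-th order stochastic Kronecker graph generated by `P`, as a measure on edge
indicators: each edge `e` is present (`true`) independently with probability `edgeProb e`. -/
def law {k : ℕ} (P : Matrix (Fin k) (Fin k) ℝ) (hP : P.IsSymm)
    (h01 : ∀ i j, P i j ∈ Set.Icc (0 : ℝ) 1) (t : ℕ) :
    Measure (Sym2 (Fin t → Fin k) → Bool) :=
  Measure.pi fun e => ProbabilityTheory.bernoulliMeasure true false (edgeProb P hP h01 t e)

/-- The graph `G` with the given edge indicators. Loops are dropped: they affect neither
connectivity nor distances. -/
def graphOf {V : Type} (ω : Sym2 V → Bool) : SimpleGraph V :=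
  SimpleGraph.fromEdgeSet {e | ω e = true}

/-- The `i`-th coordinate of the signature of the word `v`: the proportion of its symbols that are
equal to `i`. -/
def signature {k t : ℕ} (v : Fin t → Fin k) (i : Fin k) : ℝ :=
  ((Finset.univ.filter fun j => v j = i).card : ℝ) / t

/-- The set of vertices whose signature satisfies `σ_i > (1 - ε) π_i` for all `i`. -/
def core {k : ℕ} (π : Fin k → ℝ) (ε : ℝ) (t : ℕ) : Set (Fin t → Fin k) :=
  {v | ∀ i, (1 - ε) * π i < signature v i}

end Kronecker

end

/-! Put `M = C⁻¹P` and `π_i = c_i / vol(W)`, the unique stationary law of `M`. The probability of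
the edge `uv` is the expected degree of `u` (loop included) times the transition probability from
`u` to `v` of the `t`-fold product walk, and that degree is `∏ c_(u_s) = vol(W)^t · ∏ π_(u_s)`
(`kronPow_eq_mul_walk`, `wordWeight_colSum`). The upper bound on `ε` makes every degree in the core
at least `e^(δt)` (`exists_exp_le_wordWeight`). The product walk is reversible and inherits the
spectral gap of `M` for every `t` (`HasGap.kronPow`), so each set of mass at most 1/2 has a large
flow out of it (`IsReversible.cut`).

Near the boundary of the core the walk may leave it, so expansion is used only inside a `χ²` ball
`D` around `π` contained in the core. There `M` contracts the distance to `π` by more than the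
random fluctuation of the signature, and the walk rarely escapes (`eventually_chiSq_stays`). For `S
⊆ T ⊆ D` with `S` of mass at most 1/2 and `T` only slightly heavier, the expected number of edges
from `S` to `D \ T` is then at least a constant times `e^(δt/2) |T|` (`IsReversible.expansion`),
which beats the number of pairs `(S, T)` in a union bound. Balls in `D` therefore grow geometrically
in mass, exceed one half after `O(t)` steps, and meet.

When `ε < 1`, the rest of the core reaches `D` through boundedly many shrinking cores. One step of
`M` need not move a boundary signature inward, but a slight tilt of `M` does
(`exists_tilted_matrix`); it costs a factor `e^(ηt)`, which the degree `e^(δt)` absorbs. When `ε >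
1` the core contains all words and no descent is needed. Finally `ln |S_ε|` is at least a multiple
of `t` (`eventually_log_card_core`). -/

namespace Kronecker

/-! ### Reversible chains, spectral gap and flow out of sets -/

/-- A stochastic matrix `M` on a finite set which is reversible with respect to the probability
vector `μ`. -/
structure IsReversible {X : Type*} [Fintype X] (μ : X → ℝ) (M : Matrix X X ℝ) : Prop where
  nonneg : ∀ x, 0 ≤ μ x
  sum_eq_one : ∑ x, μ x = 1
  matrix_nonneg : ∀ x y, 0 ≤ M x y
  row_sum : ∀ x, ∑ y, M x y = 1
  balance : ∀ x y, μ x * M x y = μ y * M y x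

/-- `M` contracts the square of the `L²(μ)` norm of mean-zero functions by the factor `lam`. -/
def HasGap {X : Type*} [Fintype X] (μ : X → ℝ) (M : Matrix X X ℝ) (lam : ℝ) : Prop :=
  ∀ f : X → ℝ, ∑ x, μ x * f x = 0 →
    ∑ x, μ x * (M *ᵥ f) x ^ 2 ≤ lam * ∑ x, μ x * f x ^ 2

section Chain

variable {X : Type*} [Fintype X] {μ : X → ℝ} {M : Matrix X X ℝ}

theorem IsReversible.stationary (h : IsReversible μ M) (y : X) : ∑ x, μ x * M x y = μ y := by
  simp_rw [h.balance _ y]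
  rw [← Finset.mul_sum, h.row_sum, mul_one]

theorem IsReversible.mean_mulVec (h : IsReversible μ M) (f : X → ℝ) :
    ∑ x, μ x * (M *ᵥ f) x = ∑ x, μ x * f x := by
  simp only [Matrix.mulVec, dotProduct, Finset.mul_sum]
  rw [Finset.sum_comm]
  refine Finset.sum_congr rfl fun y _ => ?_
  rw [← h.stationary y, Finset.sum_mul]
  exact Finset.sum_congr rfl fun x _ => (mul_assoc _ _ _).symm

theorem IsReversible.sq_mulVec_le (h : IsReversible μ M) (f : X → ℝ) (x : X) :
    (M *ᵥ f) x ^ 2 ≤ (M *ᵥ fun y => f y ^ 2) x := by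
  have key := Finset.sum_sq_le_sum_mul_sum_of_sq_le_mul Finset.univ
    (r := fun y => M x y * f y) (f := fun y => M x y) (g := fun y => M x y * f y ^ 2)
    (fun y _ => h.matrix_nonneg x y)
    (fun y _ => mul_nonneg (h.matrix_nonneg x y) (sq_nonneg _)) (fun y _ => le_of_eq (by ring))
  rw [h.row_sum, one_mul] at key
  exact key

theorem IsReversible.norm_mulVec_le (h : IsReversible μ M) (f : X → ℝ) :
    ∑ x, μ x * (M *ᵥ f) x ^ 2 ≤ ∑ x, μ x * f x ^ 2 := by
  rw [← h.mean_mulVec fun x => f x ^ 2]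
  exact Finset.sum_le_sum fun x _ => mul_le_mul_of_nonneg_left (h.sq_mulVec_le f x) (h.nonneg x)

theorem IsReversible.sum_sq_sub_mean (h : IsReversible μ M) (f : X → ℝ) :
    ∑ x, μ x * (f x - ∑ y, μ y * f y) ^ 2 = ∑ x, μ x * f x ^ 2 - (∑ y, μ y * f y) ^ 2 := by
  set m := ∑ y, μ y * f y with hm
  have : ∀ x, μ x * (f x - m) ^ 2 = μ x * f x ^ 2 - 2 * m * (μ x * f x) + μ x * m ^ 2 :=
    fun x => by ring
  simp_rw [this, Finset.sum_add_distrib, Finset.sum_sub_distrib, ← Finset.mul_sum,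
    ← Finset.sum_mul, h.sum_eq_one, ← hm]
  ring

theorem IsReversible.sum_sub_mean (h : IsReversible μ M) (f : X → ℝ) :
    ∑ x, μ x * (f x - ∑ y, μ y * f y) = 0 := by
  simp_rw [mul_sub, Finset.sum_sub_distrib, ← Finset.sum_mul, h.sum_eq_one]
  ring

theorem IsReversible.mulVec_sub_const (h : IsReversible μ M) (f : X → ℝ) (c : ℝ) (x : X) :
    (M *ᵥ fun y => f y - c) x = (M *ᵥ f) x - c := by
  simp only [Matrix.mulVec, dotProduct, mul_sub, Finset.sum_sub_distrib, ← Finset.sum_mul,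
    h.row_sum, one_mul]

/-- The contraction estimate for functions that need not have mean zero. -/
theorem IsReversible.gap_general (h : IsReversible μ M) {lam : ℝ} (hg : HasGap μ M lam)
    (f : X → ℝ) :
    ∑ x, μ x * (M *ᵥ f) x ^ 2 ≤
      lam * ∑ x, μ x * (f x - ∑ y, μ y * f y) ^ 2 + (∑ y, μ y * f y) ^ 2 := by
  have h1 := hg _ (h.sum_sub_mean f)
  have h2 := h.sum_sq_sub_mean (M *ᵥ f)
  rw [h.mean_mulVec f] at h2
  simp_rw [h.mulVec_sub_const] at h1
  linarith

/-- A spectral gap bounds the flow out of a set from below. -/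
theorem IsReversible.cut (h : IsReversible μ M) [DecidableEq X] {lam : ℝ} (hg : HasGap μ M lam)
    (S : Finset X) :
    (1 - lam) / 2 * ((∑ x ∈ S, μ x) * (1 - ∑ x ∈ S, μ x)) ≤ ∑ x ∈ S, ∑ y ∈ Sᶜ, μ x * M x y := by
  set f : X → ℝ := fun x => if x ∈ S then 1 else 0 with hf
  set m := ∑ x ∈ S, μ x with hm
  have hmean : ∑ x, μ x * f x = m := by simp [hf, hm]
  have hsq : ∑ x, μ x * f x ^ 2 = m := by simp [hf, hm]
  have hvar := h.sum_sq_sub_mean f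
  have hc := h.gap_general hg f
  have hin : ∑ x, μ x * (f x * (M *ᵥ f) x) = ∑ x ∈ S, ∑ y ∈ S, μ x * M x y := by
    simp only [hf, Matrix.mulVec, dotProduct, ite_mul, one_mul, zero_mul, mul_ite, mul_zero,
      mul_one, Finset.sum_ite_mem, Finset.univ_inter, Finset.mul_sum]
    simp [Finset.sum_ite_irrel]
  have htot : ∑ x ∈ S, ∑ y ∈ S, μ x * M x y + ∑ x ∈ S, ∑ y ∈ Sᶜ, μ x * M x y = m := by
    rw [← Finset.sum_add_distrib]
    refine Finset.sum_congr rfl fun x _ => ?_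
    rw [Finset.sum_add_sum_compl, ← Finset.mul_sum, h.row_sum, mul_one]
  have hprod : ∑ x, μ x * ((f x - m) * ((M *ᵥ f) x - m)) =
      ∑ x, μ x * (f x * (M *ᵥ f) x) - m ^ 2 := by
    have e : ∀ x, μ x * ((f x - m) * ((M *ᵥ f) x - m)) =
        μ x * (f x * (M *ᵥ f) x) - m * (μ x * f x) - m * (μ x * (M *ᵥ f) x) + μ x * m ^ 2 :=
      fun x => by ring
    simp_rw [e, Finset.sum_add_distrib, Finset.sum_sub_distrib, ← Finset.mul_sum,
      ← Finset.sum_mul, h.sum_eq_one, h.mean_mulVec, hmean]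
    ring
  have hvarM := h.sum_sq_sub_mean (M *ᵥ f)
  rw [h.mean_mulVec, hmean] at hvarM
  rw [hmean, hsq] at hvar
  rw [hmean, hvar] at hc
  -- The covariance of `f` and `Mf` is at most the mean of their variances, `m(1-m)` and at most
  -- `lam · m(1-m)`; what stays inside `S` is this covariance plus `m²`.
  have hamgm : ∑ x, μ x * ((f x - m) * ((M *ᵥ f) x - m)) ≤
      (∑ x, μ x * (f x - m) ^ 2 + ∑ x, μ x * ((M *ᵥ f) x - m) ^ 2) / 2 := by
    rw [← Finset.sum_add_distrib, Finset.sum_div]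
    refine Finset.sum_le_sum fun x _ => ?_
    have := mul_nonneg (h.nonneg x) (sq_nonneg ((f x - m) - ((M *ᵥ f) x - m)))
    nlinarith
  rw [hvar, hvarM, hprod, hin] at hamgm
  nlinarith

end Chain

/-! ### Tensor products of chains keep the gap -/

section Product

variable {X Y : Type*} [Fintype X] [Fintype Y] {μ : X → ℝ} {ν : Y → ℝ}
  {M : Matrix X X ℝ} {N : Matrix Y Y ℝ}

theorem IsReversible.prod (hM : IsReversible μ M) (hN : IsReversible ν N) :
    IsReversible (fun z : X × Y => μ z.1 * ν z.2)
      (Matrix.of fun z w => M z.1 w.1 * N z.2 w.2) where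
  nonneg z := mul_nonneg (hM.nonneg _) (hN.nonneg _)
  sum_eq_one := by
    rw [Fintype.sum_prod_type, ← Finset.sum_mul_sum, hM.sum_eq_one, hN.sum_eq_one, one_mul]
  matrix_nonneg z w := mul_nonneg (hM.matrix_nonneg _ _) (hN.matrix_nonneg _ _)
  row_sum z := by
    simp only [Matrix.of_apply]
    rw [Fintype.sum_prod_type, ← Finset.sum_mul_sum, hM.row_sum, hN.row_sum, one_mul]
  balance z w := by
    simp only [Matrix.of_apply]
    linear_combination (ν z.2 * N z.2 w.2) * hM.balance z.1 w.1 +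
      (μ w.1 * M w.1 z.1) * hN.balance z.2 w.2

/-- Split `F` into its average `Fb` over the first coordinate and the fluctuation `F - Fb`, which
are orthogonal. The gap of `M` contracts the fluctuation, on which `N` is merely a contraction; the
gap of `N` contracts `Fb`. -/
theorem HasGap.prod (hM : IsReversible μ M) (hN : IsReversible ν N) {lam : ℝ} (h0 : 0 ≤ lam)
    (gM : HasGap μ M lam) (gN : HasGap ν N lam) :
    HasGap (fun z : X × Y => μ z.1 * ν z.2)
      (Matrix.of fun z w => M z.1 w.1 * N z.2 w.2) lam := by
  intro F hF
  set Fb : Y → ℝ := fun y => ∑ x, μ x * F (x, y) with hFb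
  set G : Y → X → ℝ := fun y x => (N *ᵥ fun y' => F (x, y')) y with hG
  have hmean : ∑ y, ν y * Fb y = 0 := by
    rw [← hF, Fintype.sum_prod_type, Finset.sum_comm]
    simp only [hFb, Finset.mul_sum]
    exact Finset.sum_congr rfl fun y _ => Finset.sum_congr rfl fun x _ => by ring
  have hMG : ∀ x y, ((Matrix.of fun z w : X × Y => M z.1 w.1 * N z.2 w.2) *ᵥ F) (x, y) =
      (M *ᵥ G y) x := by
    intro x y
    simp only [hG, Matrix.mulVec, dotProduct, Matrix.of_apply, Fintype.sum_prod_type,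
      Finset.mul_sum, mul_assoc]
  have hGb : ∀ y, ∑ x, μ x * G y x = (N *ᵥ Fb) y := by
    intro y
    simp only [hG, hFb, Matrix.mulVec, dotProduct, Finset.mul_sum]
    rw [Finset.sum_comm]
    exact Finset.sum_congr rfl fun y' _ => Finset.sum_congr rfl fun x _ => by ring
  have hdiff : ∀ x y, G y x - (N *ᵥ Fb) y = (N *ᵥ fun y' => F (x, y') - Fb y') y := by
    intro x y
    simp only [hG, Matrix.mulVec, dotProduct, mul_sub, Finset.sum_sub_distrib]
  have hvar : ∀ y, ∑ x, μ x * (F (x, y) - Fb y) ^ 2 = ∑ x, μ x * F (x, y) ^ 2 - Fb y ^ 2 :=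
    fun y => hM.sum_sq_sub_mean fun x => F (x, y)
  calc ∑ z : X × Y, μ z.1 * ν z.2 *
        ((Matrix.of fun z w : X × Y => M z.1 w.1 * N z.2 w.2) *ᵥ F) z ^ 2
      = ∑ y, ν y * ∑ x, μ x * (M *ᵥ G y) x ^ 2 := by
        rw [Fintype.sum_prod_type, Finset.sum_comm]
        simp only [hMG, Finset.mul_sum]
        exact Finset.sum_congr rfl fun y _ => Finset.sum_congr rfl fun x _ => by ring
    _ ≤ ∑ y, ν y * (lam * ∑ x, μ x * (G y x - (N *ᵥ Fb) y) ^ 2 + (N *ᵥ Fb) y ^ 2) := by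
        refine Finset.sum_le_sum fun y _ => mul_le_mul_of_nonneg_left ?_ (hN.nonneg y)
        have := hM.gap_general gM (G y)
        rwa [hGb] at this
    _ = lam * ∑ x, μ x * ∑ y, ν y * (N *ᵥ fun y' => F (x, y') - Fb y') y ^ 2 +
          ∑ y, ν y * (N *ᵥ Fb) y ^ 2 := by
        simp only [mul_add, Finset.sum_add_distrib, hdiff, Finset.mul_sum]
        rw [Finset.sum_comm]
        congr 1
        exact Finset.sum_congr rfl fun x _ => Finset.sum_congr rfl fun y _ => by ring
    _ ≤ lam * ∑ x, μ x * ∑ y, ν y * (F (x, y) - Fb y) ^ 2 + lam * ∑ y, ν y * Fb y ^ 2 := by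
        refine add_le_add (mul_le_mul_of_nonneg_left (Finset.sum_le_sum fun x _ =>
          mul_le_mul_of_nonneg_left (hN.norm_mulVec_le _) (hM.nonneg x)) h0) (gN Fb hmean)
    _ = lam * ∑ y, ν y * (∑ x, μ x * (F (x, y) - Fb y) ^ 2 + Fb y ^ 2) := by
        rw [← mul_add]
        congr 1
        simp only [mul_add, Finset.sum_add_distrib, Finset.mul_sum]
        rw [Finset.sum_comm]
        congr 1
        exact Finset.sum_congr rfl fun x _ => Finset.sum_congr rfl fun y _ => by ring
    _ = lam * ∑ z : X × Y, μ z.1 * ν z.2 * F z ^ 2 := by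
        congr 1
        rw [Fintype.sum_prod_type, Finset.sum_comm]
        refine Finset.sum_congr rfl fun y _ => ?_
        rw [hvar, sub_add_cancel, Finset.mul_sum]
        exact Finset.sum_congr rfl fun x _ => by ring

theorem IsReversible.reindex (e : Y ≃ X) (hM : IsReversible μ M) :
    IsReversible (μ ∘ e) (M.submatrix e e) where
  nonneg y := hM.nonneg _
  sum_eq_one := by rw [← hM.sum_eq_one]; exact e.sum_comp μ
  matrix_nonneg _ _ := hM.matrix_nonneg _ _
  row_sum y := by rw [← hM.row_sum (e y)]; exact e.sum_comp (M (e y))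
  balance _ _ := hM.balance _ _

theorem HasGap.reindex (e : Y ≃ X) {lam : ℝ} (g : HasGap μ M lam) :
    HasGap (μ ∘ e) (M.submatrix e e) lam := by
  intro f hf
  have h1 := g (f ∘ e.symm) (by rw [← hf, ← e.sum_comp]; simp)
  rw [← e.sum_comp, ← e.sum_comp (fun x => μ x * (f ∘ e.symm) x ^ 2)] at h1
  have h2 : ∀ y, (M *ᵥ (f ∘ e.symm)) (e y) = (M.submatrix e e *ᵥ f) y := by
    intro y
    simp only [Matrix.mulVec, dotProduct]
    rw [← e.sum_comp]
    simp
  simpa [h2] using h1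

end Product

/-- The product weight of a word. -/
def wordWeight {k : ℕ} (π : Fin k → ℝ) (t : ℕ) (u : Fin t → Fin k) : ℝ :=
  ∏ s, π (u s)

theorem wordWeight_succ {k : ℕ} (π : Fin k → ℝ) (t : ℕ) :
    wordWeight π (t + 1) = (fun z : Fin k × (Fin t → Fin k) => π z.1 * wordWeight π t z.2) ∘
      (Fin.consEquiv fun _ => Fin k).symm := by
  funext u
  simp [wordWeight, Fin.consEquiv, Fin.prod_univ_succ, Fin.tail]

theorem kronPow_succ {k : ℕ} (M : Matrix (Fin k) (Fin k) ℝ) (t : ℕ) :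
    kronPow M (t + 1) = (Matrix.of fun z w : Fin k × (Fin t → Fin k) =>
      M z.1 w.1 * kronPow M t z.2 w.2).submatrix (Fin.consEquiv fun _ => Fin k).symm
        (Fin.consEquiv fun _ => Fin k).symm := by
  ext u v
  simp [kronPow, Fin.consEquiv, Fin.prod_univ_succ, Fin.tail]

theorem IsReversible.kronPow {k : ℕ} {π : Fin k → ℝ} {M : Matrix (Fin k) (Fin k) ℝ}
    (h : IsReversible π M) (t : ℕ) : IsReversible (wordWeight π t) (kronPow M t) := by
  induction t with
  | zero =>
    constructor <;> simp [wordWeight, Kronecker.kronPow]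
  | succ t ih =>
    rw [wordWeight_succ, kronPow_succ]
    exact (h.prod ih).reindex _

theorem HasGap.kronPow {k : ℕ} {π : Fin k → ℝ} {M : Matrix (Fin k) (Fin k) ℝ}
    (h : IsReversible π M) {lam : ℝ} (h0 : 0 ≤ lam) (g : HasGap π M lam) (t : ℕ) :
    HasGap (wordWeight π t) (kronPow M t) lam := by
  induction t with
  | zero =>
    intro f hf
    have : f default = 0 := by simpa [wordWeight] using hf
    simp [Matrix.mulVec, dotProduct, wordWeight, this]
  | succ t ih =>
    rw [wordWeight_succ, kronPow_succ]
    exact (HasGap.prod h (h.kronPow t) h0 g ih).reindex _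

/-! ### Existence of a gap by compactness -/

section Gap

variable {X : Type*} [Fintype X] {μ : X → ℝ} {M : Matrix X X ℝ}

/-- The loss of norm is the mean over `x` of the variance of `f` under `M x ·`; if there is no loss,
`f` is constant on the support of each row. -/
theorem IsReversible.eq_mulVec_of_norm_eq (h : IsReversible μ M) (hμ : ∀ x, 0 < μ x) (f : X → ℝ)
    (heq : ∑ x, μ x * f x ^ 2 ≤ ∑ x, μ x * (M *ᵥ f) x ^ 2) (x y : X) (hxy : 0 < M x y) :
    f y = (M *ᵥ f) x := by
  rw [← h.mean_mulVec fun x => f x ^ 2] at heq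
  have hz : ∑ x, μ x * ((M *ᵥ fun y => f y ^ 2) x - (M *ᵥ f) x ^ 2) = 0 := by
    refine le_antisymm ?_ (Finset.sum_nonneg fun x _ =>
      mul_nonneg (h.nonneg x) (sub_nonneg.2 (h.sq_mulVec_le f x)))
    simp_rw [mul_sub, Finset.sum_sub_distrib]
    linarith
  rw [Finset.sum_eq_zero_iff_of_nonneg fun x _ =>
    mul_nonneg (h.nonneg x) (sub_nonneg.2 (h.sq_mulVec_le f x))] at hz
  have hx := (mul_eq_zero.1 (hz x (Finset.mem_univ x))).resolve_left (hμ x).ne'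
  have hs : ∑ y, M x y * (f y - (M *ᵥ f) x) ^ 2 = 0 := by
    set m := (M *ᵥ f) x with hm
    have e : ∀ y, M x y * (f y - m) ^ 2 = M x y * f y ^ 2 - 2 * m * (M x y * f y) + M x y * m ^ 2 :=
      fun y => by ring
    have hm' : ∑ y, M x y * f y = m := rfl
    have hq : ∑ y, M x y * f y ^ 2 = m ^ 2 := sub_eq_zero.1 hx
    simp_rw [e, Finset.sum_add_distrib, Finset.sum_sub_distrib, ← Finset.mul_sum,
      ← Finset.sum_mul, h.row_sum, hm', hq]
    ring
  rw [Finset.sum_eq_zero_iff_of_nonneg fun y _ =>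
    mul_nonneg (h.matrix_nonneg x y) (sq_nonneg _)] at hs
  have := (mul_eq_zero.1 (hs y (Finset.mem_univ y))).resolve_left hxy.ne'
  exact sub_eq_zero.1 (pow_eq_zero_iff (two_ne_zero)|>.1 this)

theorem isCompact_meanZero_sphere (hμ : ∀ x, 0 < μ x) :
    IsCompact {f : X → ℝ | ∑ x, μ x * f x = 0 ∧ ∑ x, μ x * f x ^ 2 = 1} := by
  refine IsCompact.of_isClosed_subset
    (isCompact_univ_pi fun x => isCompact_Icc (a := -(1 + 1 / μ x)) (b := 1 + 1 / μ x)) ?_ ?_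
  · exact (isClosed_eq (by fun_prop) continuous_const).inter
      (isClosed_eq (by fun_prop) continuous_const)
  · rintro f ⟨-, hf⟩ x -
    have h1 : μ x * f x ^ 2 ≤ 1 := by
      rw [← hf]
      exact Finset.single_le_sum (f := fun x => μ x * f x ^ 2)
        (fun x _ => mul_nonneg (hμ x).le (sq_nonneg _)) (Finset.mem_univ x)
    have h2 : f x ^ 2 ≤ 1 / μ x := by
      rw [le_div_iff₀ (hμ x)]; linarith
    have h3 : 0 < 1 / μ x := one_div_pos.2 (hμ x)
    exact abs_le.1 (abs_le_of_sq_le_sq (by nlinarith) (by linarith))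

/-- The norm of `Mf` attains its maximum on the compact mean-zero unit sphere, and rigidity keeps
this maximum below 1. Since the norm is squared, eigenvalues near `-1` are excluded too. -/
theorem IsReversible.exists_gap (h : IsReversible μ M) (hμ : ∀ x, 0 < μ x)
    (hrigid : ∀ f : X → ℝ, ∑ x, μ x * f x = 0 →
      (∀ x y, 0 < M x y → f y = (M *ᵥ f) x) → f = 0) :
    ∃ lam, 0 ≤ lam ∧ lam < 1 ∧ HasGap μ M lam := by
  set K := {f : X → ℝ | ∑ x, μ x * f x = 0 ∧ ∑ x, μ x * f x ^ 2 = 1} with hK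
  have hKc : IsCompact K := isCompact_meanZero_sphere hμ
  have hscale : ∀ lam, 0 ≤ lam → (∀ f ∈ K, ∑ x, μ x * (M *ᵥ f) x ^ 2 ≤ lam) →
      HasGap μ M lam := by
    intro lam h0 hl f hf
    set N := ∑ x, μ x * f x ^ 2 with hN
    have hN0 : 0 ≤ N := Finset.sum_nonneg fun x _ => mul_nonneg (h.nonneg x) (sq_nonneg _)
    rcases hN0.eq_or_lt with hz | hp
    · have := h.norm_mulVec_le f
      rw [← hN, ← hz] at this
      rw [← hz, mul_zero]
      exact this
    · have hs : (√N)⁻¹ ^ 2 = N⁻¹ := by rw [inv_pow, Real.sq_sqrt hN0]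
      have hmem : (√N)⁻¹ • f ∈ K := by
        constructor
        · have : ∀ x, μ x * ((√N)⁻¹ • f) x = (√N)⁻¹ * (μ x * f x) := fun x => by
            simp only [Pi.smul_apply, smul_eq_mul]; ring
          simp_rw [this, ← Finset.mul_sum, hf, mul_zero]
        · have : ∀ x, μ x * ((√N)⁻¹ • f) x ^ 2 = (√N)⁻¹ ^ 2 * (μ x * f x ^ 2) := fun x => by
            simp only [Pi.smul_apply, smul_eq_mul]; ring
          simp_rw [this, ← Finset.mul_sum, ← hN, hs]
          exact inv_mul_cancel₀ hp.ne'
      have := hl _ hmem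
      have e : ∀ x, μ x * (M *ᵥ ((√N)⁻¹ • f)) x ^ 2 = N⁻¹ * (μ x * (M *ᵥ f) x ^ 2) := fun x => by
        rw [Matrix.mulVec_smul, ← hs]
        simp only [Pi.smul_apply, smul_eq_mul]; ring
      simp_rw [e, ← Finset.mul_sum] at this
      rwa [inv_mul_le_iff₀ hp, mul_comm] at this
  rcases K.eq_empty_or_nonempty with he | hne
  · exact ⟨0, le_rfl, one_pos, hscale 0 le_rfl (by simp [he])⟩
  · have hcont : Continuous fun f : X → ℝ => ∑ x, μ x * (M *ᵥ f) x ^ 2 := by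
      simp only [Matrix.mulVec, dotProduct]
      fun_prop
    obtain ⟨f, hf, hmax⟩ := hKc.exists_isMaxOn hne hcont.continuousOn
    refine ⟨∑ x, μ x * (M *ᵥ f) x ^ 2,
      Finset.sum_nonneg fun x _ => mul_nonneg (h.nonneg x) (sq_nonneg _), ?_,
      hscale _ (Finset.sum_nonneg fun x _ => mul_nonneg (h.nonneg x) (sq_nonneg _)) hmax⟩
    by_contra hge
    have hf0 := hrigid f hf.1 (h.eq_mulVec_of_norm_eq hμ f (by rw [hf.2]; exact not_lt.1 hge))
    have := hf.2
    simp [hf0] at this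

end Gap

/-! ### The random walk on `W` and its stationary law -/

section Walk

variable {k : ℕ} {P : Matrix (Fin k) (Fin k) ℝ}

/-- On a single vertex connectedness gives no edge; non-bipartiteness then supplies a loop. -/
theorem exists_pos_of_connected (hP : P.IsSymm) (hconn : WConnected P)
    (hbip : ¬ WBipartite P) (i : Fin k) : ∃ j, 0 < P i j := by
  rcases subsingleton_or_nontrivial (Fin k) with hs | hn
  · by_contra hcon
    push Not at hcon
    refine hbip ⟨fun _ => true, fun a b hab => ?_⟩
    rw [Subsingleton.elim a i] at hab
    exact absurd (hcon b) hab.not_ge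
  · obtain ⟨j, hj⟩ := hconn.preconnected.exists_adj_of_nontrivial i
    rw [supportGraph, SimpleGraph.fromRel_adj] at hj
    rcases hj.2 with h | h
    · exact ⟨j, h⟩
    · exact ⟨j, by rwa [← hP.apply]⟩

theorem sum_row_eq_colSum (hP : P.IsSymm) (i : Fin k) : ∑ j, P i j = colSum P i :=
  Finset.sum_congr rfl fun j _ => hP.apply j i

theorem colSum_pos (h0 : ∀ i j, 0 ≤ P i j) (hP : P.IsSymm) (hconn : WConnected P)
    (hbip : ¬ WBipartite P) (i : Fin k) : 0 < colSum P i := by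
  obtain ⟨j, hj⟩ := exists_pos_of_connected hP hconn hbip i
  rw [← sum_row_eq_colSum hP]
  exact Finset.sum_pos' (fun j _ => h0 i j) ⟨j, Finset.mem_univ j, hj⟩

theorem isReversible_walkMatrix [Nonempty (Fin k)] (h0 : ∀ i j, 0 ≤ P i j) (hP : P.IsSymm)
    (hc : ∀ i, 0 < colSum P i) :
    IsReversible (fun i => colSum P i / vol P) (walkMatrix P) := by
  have hv : 0 < vol P := Finset.sum_pos (fun i _ => hc i) Finset.univ_nonempty
  constructor
  · exact fun x => (div_pos (hc x) hv).le
  · rw [← Finset.sum_div]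
    exact div_self hv.ne'
  · exact fun x y => div_nonneg (h0 x y) (hc x).le
  · intro x
    simp only [walkMatrix, Matrix.of_apply]
    rw [← Finset.sum_div, sum_row_eq_colSum hP, div_self (hc x).ne']
  · intro x y
    have := hc x
    have := hc y
    simp only [walkMatrix, Matrix.of_apply]
    rw [← hP.apply x y]
    field_simp

/-- Equality in the contraction estimate forces a mean-zero function to vanish, by connectedness
and non-bipartiteness. -/
theorem eq_zero_of_eq_mulVec (hP : P.IsSymm) (hconn : WConnected P)
    (hbip : ¬ WBipartite P) {μ g f : Fin k → ℝ} (hμ : ∑ i, μ i = 1)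
    (hf : ∑ i, μ i * f i = 0) (hfg : ∀ i j, 0 < P i j → f j = g i) : f = 0 := by
  have hfg' : ∀ i j, 0 < P i j → f i = g j := fun i j hij => hfg j i (by rwa [hP.apply])
  -- Crossing an edge exchanges the values of `f` and `g`, so it keeps `f + g` and negates `f - g`.
  have hcon : ∀ i j, (supportGraph P).Reachable i j →
      (f j - g j = f i - g i ∨ f j - g j = -(f i - g i)) ∧ f j + g j = f i + g i := by
    intro i j hij
    rw [SimpleGraph.reachable_iff_reflTransGen] at hij
    induction hij with
    | refl => exact ⟨Or.inl rfl, rfl⟩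
    | @tail b c _ hbc ih =>
      have h1 : f c = g b ∧ f b = g c := by
        rw [supportGraph, SimpleGraph.fromRel_adj] at hbc
        rcases hbc.2 with h | h
        · exact ⟨hfg _ _ h, hfg' _ _ h⟩
        · exact ⟨hfg' _ _ h, hfg _ _ h⟩
      obtain ⟨h2, h3⟩ := ih
      constructor
      · rcases h2 with h2 | h2
        · right; linarith [h1.1, h1.2]
        · left; linarith [h1.1, h1.2]
      · linarith [h1.1, h1.2]
  obtain ⟨i₀⟩ := hconn.nonempty
  by_cases hd : f i₀ = g i₀
  · have hconst : ∀ j, f j = f i₀ := by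
      intro j
      obtain ⟨h1, h2⟩ := hcon i₀ j (hconn.preconnected i₀ j)
      rcases h1 with h1 | h1 <;> linarith
    simp_rw [hconst, ← Finset.sum_mul, hμ, one_mul] at hf
    funext j
    rw [hconst, hf, Pi.zero_apply]
  -- If `f - g` vanishes nowhere, its sign alternates along edges and is a 2-colouring of `W`.
  · exfalso
    refine hbip ⟨fun j => decide (0 < f j - g j), fun i j hij heq => ?_⟩
    have hne : f i - g i ≠ 0 := by
      rcases (hcon i₀ i (hconn.preconnected i₀ i)).1 with h | h <;> rw [h]
      · exact sub_ne_zero.2 hd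
      · exact neg_ne_zero.2 (sub_ne_zero.2 hd)
    have hj : f j - g j = -(f i - g i) := by linarith [hfg i j hij, hfg' i j hij]
    simp only [decide_eq_decide] at heq
    rw [hj] at heq
    rcases lt_or_gt_of_ne hne with h | h
    · have := heq.2 (by linarith); linarith
    · have := heq.1 h; linarith

theorem exists_gap_walkMatrix (h0 : ∀ i j, 0 ≤ P i j) (hP : P.IsSymm) (hconn : WConnected P)
    (hbip : ¬ WBipartite P) :
    ∃ lam, 0 ≤ lam ∧ lam < 1 ∧ HasGap (fun i => colSum P i / vol P) (walkMatrix P) lam := by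
  have hc := colSum_pos h0 hP hconn hbip
  have := hconn.nonempty
  have hv : 0 < vol P := Finset.sum_pos (fun i _ => hc i) Finset.univ_nonempty
  have hrev := isReversible_walkMatrix h0 hP hc
  refine hrev.exists_gap (fun i => div_pos (hc i) hv) fun f hf hfg => ?_
  exact eq_zero_of_eq_mulVec hP hconn hbip hrev.sum_eq_one hf
    fun i j hij => hfg i j (div_pos hij (hc i))

theorem IsReversible.eq_zero_of_fixed {X : Type*} [Fintype X] {μ : X → ℝ} {M : Matrix X X ℝ}
    {lam : ℝ} (h : IsReversible μ M) (hμ : ∀ x, 0 < μ x) (hl : lam < 1) (g : HasGap μ M lam)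
    {f : X → ℝ} (hf : ∑ x, μ x * f x = 0)
    (hfix : ∑ x, μ x * f x ^ 2 ≤ ∑ x, μ x * (M *ᵥ f) x ^ 2) : f = 0 := by
  have h1 := g f hf
  have h2 : 0 ≤ ∑ x, μ x * f x ^ 2 :=
    Finset.sum_nonneg fun x _ => mul_nonneg (h.nonneg x) (sq_nonneg _)
  have h3 : ∑ x, μ x * f x ^ 2 = 0 := by nlinarith
  rw [Finset.sum_eq_zero_iff_of_nonneg fun x _ => mul_nonneg (h.nonneg x) (sq_nonneg _)] at h3
  funext x
  have := (mul_eq_zero.1 (h3 x (Finset.mem_univ x))).resolve_left (hμ x).ne'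
  exact pow_eq_zero_iff two_ne_zero |>.1 this

/-- Reversibility turns the action on measures into the action on densities, where the gap applies.
-/
theorem IsReversible.vecMul_div {X : Type*} [Fintype X] {μ : X → ℝ} {M : Matrix X X ℝ}
    (h : IsReversible μ M) (hμ : ∀ x, 0 < μ x) (σ : X → ℝ) (y : X) :
    (σ ᵥ* M) y / μ y = (M *ᵥ fun x => σ x / μ x) y := by
  simp only [Matrix.vecMul, Matrix.mulVec, dotProduct, Finset.sum_div]
  refine Finset.sum_congr rfl fun x _ => ?_
  have := (hμ x).ne'
  have := (hμ y).ne'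
  field_simp
  linear_combination σ x * h.balance x y

theorem IsReversible.stationary_unique {X : Type*} [Fintype X] {μ : X → ℝ} {M : Matrix X X ℝ}
    {lam : ℝ} (h : IsReversible μ M) (hμ : ∀ x, 0 < μ x) (hl : lam < 1) (g : HasGap μ M lam)
    {σ : X → ℝ} (hs : ∑ x, σ x = 1) (hσ : σ ᵥ* M = σ) : σ = μ := by
  have hc : ∀ x, μ x * (σ x / μ x) = σ x := fun x => mul_div_cancel₀ _ (hμ x).ne'
  have hm : ∑ x, μ x * (σ x / μ x - 1) = 0 := by
    simp_rw [mul_sub, hc, mul_one, Finset.sum_sub_distrib, hs, h.sum_eq_one, sub_self]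
  have hfix : (M *ᵥ fun x => σ x / μ x - 1) = fun x => σ x / μ x - 1 := by
    funext x
    rw [h.mulVec_sub_const, ← h.vecMul_div hμ, hσ]
  have := h.eq_zero_of_fixed hμ hl g hm (by rw [hfix])
  funext x
  have hx := congrFun this x
  simp only [Pi.zero_apply, sub_eq_zero] at hx
  exact (div_eq_one_iff_eq (hμ x).ne').1 hx

theorem IsStationary.eq_colSum_div_vol (h0 : ∀ i j, 0 ≤ P i j) (hP : P.IsSymm)
    (hconn : WConnected P) (hbip : ¬ WBipartite P) {π : Fin k → ℝ}
    (hπ : IsStationary (walkMatrix P) π) : π = fun i => colSum P i / vol P := by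
  have hc := colSum_pos h0 hP hconn hbip
  have := hconn.nonempty
  have hv : 0 < vol P := Finset.sum_pos (fun i _ => hc i) Finset.univ_nonempty
  obtain ⟨lam, -, hl, hg⟩ := exists_gap_walkMatrix h0 hP hconn hbip
  exact (isReversible_walkMatrix h0 hP hc).stationary_unique (fun i => div_pos (hc i) hv) hl hg
    hπ.2.1 hπ.2.2

end Walk

/-! ### Random words with independent letters and their signatures -/

section ProductWeights

variable {ι α : Type*} [Fintype ι] [Fintype α] {w : ι → α → ℝ}

theorem sum_prod_eq_prod_sum [DecidableEq ι] (f : ι → α → ℝ) :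
    ∑ v : ι → α, ∏ s, f s (v s) = ∏ s, ∑ a, f s a := by
  rw [Finset.prod_univ_sum, Fintype.piFinset_univ]

theorem sum_prod_eq_one [DecidableEq ι] (hw : ∀ s, ∑ a, w s a = 1) :
    ∑ v : ι → α, ∏ s, w s (v s) = 1 := by
  rw [sum_prod_eq_prod_sum]
  exact Finset.prod_eq_one fun s _ => hw s

theorem sum_prod_mul_single [DecidableEq ι] (hw : ∀ s, ∑ a, w s a = 1) (s : ι) (f : α → ℝ) :
    ∑ v : ι → α, (∏ r, w r (v r)) * f (v s) = ∑ a, w s a * f a := by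
  have e : ∀ v : ι → α, (∏ r, w r (v r)) * f (v s) =
      ∏ r, w r (v r) * (if r = s then f (v r) else 1) := by
    intro v
    rw [Finset.prod_mul_distrib, Finset.prod_ite_eq' Finset.univ s]
    simp
  simp_rw [e]
  rw [sum_prod_eq_prod_sum fun r a => w r a * (if r = s then f a else 1),
    Finset.prod_eq_single s]
  · simp
  · intro r _ hr
    simp [hr, hw]
  · simp

theorem sum_prod_mul_pair [DecidableEq ι] {s s' : ι} (hs : s ≠ s')
    (f g : α → ℝ) (hf : ∑ a, w s a * f a = 0) :
    ∑ v : ι → α, (∏ r, w r (v r)) * (f (v s) * g (v s')) = 0 := by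
  have e : ∀ v : ι → α, (∏ r, w r (v r)) * (f (v s) * g (v s')) =
      ∏ r, w r (v r) * ((if r = s then f (v r) else 1) * (if r = s' then g (v r) else 1)) := by
    intro v
    rw [Finset.prod_mul_distrib, Finset.prod_mul_distrib, Finset.prod_ite_eq' Finset.univ s,
      Finset.prod_ite_eq' Finset.univ s']
    simp
  simp_rw [e]
  rw [sum_prod_eq_prod_sum fun r a =>
    w r a * ((if r = s then f a else 1) * (if r = s' then g a else 1))]
  refine Finset.prod_eq_zero (Finset.mem_univ s) ?_
  simpa [hs] using hf

/-- The variance of a sum of independent centred variables. -/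
theorem sum_prod_mul_sq [DecidableEq ι] (hw : ∀ s, ∑ a, w s a = 1) (φ : ι → α → ℝ)
    (hφ : ∀ s, ∑ a, w s a * φ s a = 0) :
    ∑ v : ι → α, (∏ r, w r (v r)) * (∑ s, φ s (v s)) ^ 2 = ∑ s, ∑ a, w s a * φ s a ^ 2 := by
  simp_rw [sq, Finset.sum_mul_sum, Finset.mul_sum]
  rw [Finset.sum_comm]
  refine Finset.sum_congr rfl fun s _ => ?_
  rw [Finset.sum_comm, Finset.sum_eq_single s]
  · exact sum_prod_mul_single hw s fun a => φ s a * φ s a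
  · intro s' _ hs
    exact sum_prod_mul_pair hs.symm (φ s) (φ s') (hφ s)
  · simp

end ProductWeights

section Signature

variable {k t : ℕ}

theorem signature_eq_sum (v : Fin t → Fin k) (i : Fin k) :
    signature v i = (∑ s, if v s = i then (1 : ℝ) else 0) / t := by
  simp [signature]

theorem signature_nonneg (v : Fin t → Fin k) (i : Fin k) : 0 ≤ signature v i := by
  unfold signature; positivity

theorem sum_signature_mul (v : Fin t → Fin k) (f : Fin k → ℝ) :
    ∑ i, signature v i * f i = (∑ s, f (v s)) / t := by
  simp_rw [signature_eq_sum, div_mul_eq_mul_div, ← Finset.sum_div, Finset.sum_mul]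
  rw [Finset.sum_comm]
  simp

theorem sum_signature (ht : 0 < t) (v : Fin t → Fin k) : ∑ i, signature v i = 1 := by
  have h := sum_signature_mul v fun _ => 1
  have : (t : ℝ) ≠ 0 := by positivity
  simpa [this] using h

/-- The variance of coordinate `i` is at most `∑ s, w s i / t²`; as each `w s` sums to one, summing
over `i` gives `1 / t` with no dependence on `k`. -/
theorem sum_prod_mul_signature_sq (ht : 0 < t) {w : Fin t → Fin k → ℝ}
    (hw : ∀ s, ∑ i, w s i = 1) :
    ∑ v : Fin t → Fin k, (∏ s, w s (v s)) * ∑ i, (signature v i - (∑ s, w s i) / t) ^ 2 ≤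
      1 / t := by
  have htr : (0 : ℝ) < t := by positivity
  have hi : ∀ i, ∑ v : Fin t → Fin k,
      (∏ s, w s (v s)) * (signature v i - (∑ s, w s i) / t) ^ 2 ≤ (∑ s, w s i) / t ^ 2 := by
    intro i
    have hφ : ∀ s, ∑ a, w s a * ((if a = i then (1 : ℝ) else 0) - w s i) = 0 := by
      intro s
      simp_rw [mul_sub, Finset.sum_sub_distrib, ← Finset.sum_mul, hw]
      simp
    have key := sum_prod_mul_sq hw (fun s a => (if a = i then (1 : ℝ) else 0) - w s i) hφ
    have e : ∀ v : Fin t → Fin k, (signature v i - (∑ s, w s i) / t) ^ 2 =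
        (∑ s, ((if v s = i then (1 : ℝ) else 0) - w s i)) ^ 2 / t ^ 2 := by
      intro v
      rw [signature_eq_sum, ← sub_div, div_pow, Finset.sum_sub_distrib]
    simp_rw [e, ← mul_div_assoc, ← Finset.sum_div]
    rw [key]
    refine div_le_div_of_nonneg_right (Finset.sum_le_sum fun s _ => ?_) (by positivity)
    have e2 : ∀ a, w s a * ((if a = i then (1 : ℝ) else 0) - w s i) ^ 2 =
        (if a = i then w s a * (1 - 2 * w s i) else 0) + w s a * w s i ^ 2 := by
      intro a
      split_ifs <;> ring
    simp_rw [e2, Finset.sum_add_distrib, ← Finset.sum_mul, hw]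
    simp only [Finset.sum_ite_eq', Finset.mem_univ, if_true, one_mul]
    nlinarith [sq_nonneg (w s i)]
  calc ∑ v : Fin t → Fin k, (∏ s, w s (v s)) * ∑ i, (signature v i - (∑ s, w s i) / t) ^ 2
      = ∑ i, ∑ v : Fin t → Fin k,
          (∏ s, w s (v s)) * (signature v i - (∑ s, w s i) / t) ^ 2 := by
        simp_rw [Finset.mul_sum]
        rw [Finset.sum_comm]
    _ ≤ ∑ i, (∑ s, w s i) / t ^ 2 := Finset.sum_le_sum fun i _ => hi i
    _ = 1 / t := by
        rw [← Finset.sum_div, Finset.sum_comm]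
        simp_rw [hw]
        simp only [Finset.sum_const, Finset.card_univ, Fintype.card_fin, nsmul_eq_mul, mul_one]
        field_simp

/-- Chebyshev's inequality for the signature of a random word with independent letters. -/
theorem signature_concentration (ht : 0 < t) {w : Fin t → Fin k → ℝ} (h0 : ∀ s i, 0 ≤ w s i)
    (hw : ∀ s, ∑ i, w s i = 1) {κ : ℝ} (hκ : 0 < κ) (B : Finset (Fin t → Fin k))
    (hB : ∀ v, (∀ i, |signature v i - (∑ s, w s i) / t| < κ) → v ∈ B) :
    1 - 1 / (t * κ ^ 2) ≤ ∑ v ∈ B, ∏ s, w s (v s) := by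
  classical
  have htr : (0 : ℝ) < t := by positivity
  have hp : ∀ v : Fin t → Fin k, 0 ≤ ∏ s, w s (v s) := fun v =>
    Finset.prod_nonneg fun s _ => h0 s _
  have h1 := sum_prod_eq_one hw
  rw [← Finset.sum_add_sum_compl B] at h1
  have h2 : κ ^ 2 * ∑ v ∈ Bᶜ, ∏ s, w s (v s) ≤ 1 / t := by
    refine le_trans ?_ (sum_prod_mul_signature_sq ht hw)
    rw [Finset.mul_sum]
    refine le_trans (Finset.sum_le_sum fun v hv => ?_) (Finset.sum_le_sum_of_subset_of_nonneg
      (Finset.subset_univ Bᶜ) fun v _ _ => mul_nonneg (hp v)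
        (Finset.sum_nonneg fun i _ => sq_nonneg _))
    have : ¬ ∀ i, |signature v i - (∑ s, w s i) / t| < κ :=
      fun h => (Finset.mem_compl.1 hv) (hB v h)
    push Not at this
    obtain ⟨i, hi⟩ := this
    rw [mul_comm]
    refine mul_le_mul_of_nonneg_left ?_ (hp v)
    refine le_trans ?_ (Finset.single_le_sum
      (f := fun i => (signature v i - (∑ s, w s i) / t) ^ 2) (fun i _ => sq_nonneg _)
      (Finset.mem_univ i))
    rw [← sq_abs (signature v i - _)]
    exact pow_le_pow_left₀ hκ.le hi 2
  have h3 : ∑ v ∈ Bᶜ, ∏ s, w s (v s) ≤ 1 / (t * κ ^ 2) := by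
    rw [le_div_iff₀ (by positivity)]
    rw [le_div_iff₀ htr] at h2
    linarith
  linarith

/-- From `u` the walk draws the letters independently from the rows `K (u s)`; this computes the
mean signature after one step. -/
theorem sum_row_div (K : Matrix (Fin k) (Fin k) ℝ) (u : Fin t → Fin k)
    (i : Fin k) : (∑ s, K (u s) i) / t = (signature u ᵥ* K) i := by
  rw [Matrix.vecMul, dotProduct, sum_signature_mul u fun j => K j i]

end Signature

/-! ### Expected degrees in the Kronecker graph -/

section Degree

variable {k : ℕ} {P : Matrix (Fin k) (Fin k) ℝ}

theorem kronPow_eq_mul_walk (hc : ∀ i, 0 < colSum P i) (t : ℕ) (u v : Fin t → Fin k) :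
    kronPow P t u v = wordWeight (colSum P) t u * kronPow (walkMatrix P) t u v := by
  simp only [kronPow, wordWeight, walkMatrix, Matrix.of_apply]
  rw [← Finset.prod_mul_distrib]
  exact Finset.prod_congr rfl fun s _ => (mul_div_cancel₀ _ (hc _).ne').symm

theorem wordWeight_colSum (hv : vol P ≠ 0) (t : ℕ) (u : Fin t → Fin k) :
    wordWeight (colSum P) t u = vol P ^ t * wordWeight (fun i => colSum P i / vol P) t u := by
  simp only [wordWeight]
  rw [Finset.prod_div_distrib, Finset.prod_const, Finset.card_univ, Fintype.card_fin,
    mul_div_cancel₀ _ (pow_ne_zero t hv)]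

theorem wordWeight_eq_exp {c : Fin k → ℝ} (hc : ∀ i, 0 < c i) {t : ℕ} (ht : 0 < t)
    (u : Fin t → Fin k) :
    wordWeight c t u = Real.exp (t * ∑ i, signature u i * Real.log (c i)) := by
  have : (t : ℝ) ≠ 0 := by positivity
  rw [sum_signature_mul, mul_div_cancel₀ _ this, Real.exp_sum]
  exact Finset.prod_congr rfl fun s _ => (Real.exp_log (hc _)).symm

theorem minColSum_le (i : Fin k) : minColSum P ≤ colSum P i :=
  ciInf_le (Set.finite_range _).bddBelow i

theorem minColSum_pos [Nonempty (Fin k)] (hc : ∀ i, 0 < colSum P i) : 0 < minColSum P := by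
  obtain ⟨i, hi⟩ := exists_eq_ciInf_of_finite (f := colSum P)
  rw [minColSum, ← hi]
  exact hc i

/-- The words in the core have exponentially large weight. -/
theorem exists_exp_le_wordWeight [Nonempty (Fin k)] (hc : ∀ i, 0 < colSum P i)
    (hpos : 0 < sumDegLogDeg P) {ε : ℝ}
    (hε : sumDegLogDeg P ≠ vol P * Real.log (minColSum P) →
      ε < sumDegLogDeg P / (sumDegLogDeg P - vol P * Real.log (minColSum P))) :
    ∃ δ > 0, ∀ t : ℕ, 0 < t → ∀ u ∈ core (fun i => colSum P i / vol P) ε t,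
      Real.exp (δ * t) ≤ wordWeight (colSum P) t u := by
  have hv : 0 < vol P := Finset.sum_pos (fun i _ => hc i) Finset.univ_nonempty
  set A := sumDegLogDeg P with hA
  set l := Real.log (minColSum P) with hl
  have hll : ∀ i, l ≤ Real.log (colSum P i) := fun i =>
    Real.log_le_log (minColSum_pos hc) (minColSum_le i)
  have hAl : vol P * l ≤ A := by
    rw [hA, sumDegLogDeg, vol, Finset.sum_mul]
    exact Finset.sum_le_sum fun i _ => mul_le_mul_of_nonneg_left (hll i) (hc i).le
  have hδ : 0 < A - ε * (A - vol P * l) := by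
    rcases hAl.eq_or_lt with h | h
    · rw [h, sub_self, mul_zero, sub_zero]; exact hpos
    · have := hε h.ne'
      rw [lt_div_iff₀ (by linarith)] at this
      linarith
  -- This exponent equals `(1 - ε) A / vol + ε l`: mass `ε` is charged at the smallest logarithm.
  refine ⟨(A - ε * (A - vol P * l)) / vol P, div_pos hδ hv, fun t ht u hu => ?_⟩
  rw [wordWeight_eq_exp hc ht, mul_comm _ (t : ℝ)]
  refine Real.exp_le_exp.2 (mul_le_mul_of_nonneg_left ?_ (by positivity))
  -- Subtracting `l` makes the coefficients nonnegative, so the lower bounds on the signature can be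
  -- summed.
  have h1 : ∑ i, (1 - ε) * (colSum P i / vol P) * (Real.log (colSum P i) - l) ≤
      ∑ i, signature u i * (Real.log (colSum P i) - l) :=
    Finset.sum_le_sum fun i _ => mul_le_mul_of_nonneg_right (hu i).le (sub_nonneg.2 (hll i))
  have h2 : ∑ i, (1 - ε) * (colSum P i / vol P) * (Real.log (colSum P i) - l) =
      (1 - ε) * ((A - vol P * l) / vol P) := by
    rw [hA, sumDegLogDeg, vol, Finset.sum_mul, ← Finset.sum_sub_distrib, Finset.sum_div,
      Finset.mul_sum]
    exact Finset.sum_congr rfl fun i _ => by ring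
  simp_rw [mul_sub (signature u _), Finset.sum_sub_distrib, ← Finset.sum_mul,
    sum_signature ht, one_mul] at h1
  rw [h2] at h1
  have h3 : (A - ε * (A - vol P * l)) / vol P = (1 - ε) * ((A - vol P * l) / vol P) + l := by
    field_simp
    ring
  linarith

end Degree

theorem exists_pos_le {k : ℕ} {π : Fin k → ℝ} (hπ : ∀ i, 0 < π i) : ∃ p > 0, ∀ i, p ≤ π i := by
  rcases isEmpty_or_nonempty (Fin k) with h | h
  · exact ⟨1, one_pos, fun i => (h.false i).elim⟩
  · obtain ⟨i, hi⟩ := Finite.exists_min π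
    exact ⟨π i, hπ i, hi⟩

theorem eventually_inv_mul_le {κ η : ℝ} (hκ : 0 < κ) (hη : 0 < η) :
    ∀ᶠ t : ℕ in atTop, 0 < t ∧ 1 / (t * κ ^ 2) ≤ η := by
  filter_upwards [eventually_gt_atTop 0,
    tendsto_natCast_atTop_atTop.eventually_ge_atTop (1 / (κ ^ 2 * η))] with t ht h
  refine ⟨ht, ?_⟩
  have htr : (0 : ℝ) < t := by positivity
  rw [div_le_iff₀ (by positivity)] at h ⊢
  linarith

/-! ### The `χ²` ball around `π` retains the walk -/

section ChiSquare

/-- The `χ²` distance of `σ` to `π`. -/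
noncomputable def chiSq {k : ℕ} (π σ : Fin k → ℝ) : ℝ :=
  ∑ i, π i * (σ i / π i - 1) ^ 2

variable {k : ℕ} {π : Fin k → ℝ} {M : Matrix (Fin k) (Fin k) ℝ} {lam : ℝ}

theorem chiSq_vecMul_le (h : IsReversible π M) (hπ : ∀ i, 0 < π i) (g : HasGap π M lam)
    {σ : Fin k → ℝ} (hσ : ∑ i, σ i = 1) : chiSq π (σ ᵥ* M) ≤ lam * chiSq π σ := by
  have hc : ∀ x, π x * (σ x / π x) = σ x := fun x => mul_div_cancel₀ _ (hπ x).ne'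
  have hm : ∑ x, π x * (σ x / π x - 1) = 0 := by
    simp_rw [mul_sub, hc, mul_one, Finset.sum_sub_distrib, hσ, h.sum_eq_one, sub_self]
  have := g _ hm
  simp_rw [h.mulVec_sub_const, ← h.vecMul_div hπ] at this
  exact this

/-- The weighted inequality `(a + b)² ≤ (1 + β) a² + (1 + 1/β) b²`: a small `β` barely spoils the
contraction by `lam`, and the price falls on the fluctuation `κ`, which is free to be small. -/
theorem chiSq_le_of_close (hπ : ∀ i, 0 < π i) (hs : ∑ i, π i = 1) {p : ℝ} (hp : 0 < p)
    (hpπ : ∀ i, p ≤ π i) {σ τ : Fin k → ℝ} {κ β : ℝ} (hβ : 0 < β)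
    (hκ : ∀ i, |σ i - τ i| < κ) :
    chiSq π σ ≤ (1 + β) * chiSq π τ + (1 + 1 / β) * (κ / p) ^ 2 := by
  have hi : ∀ i, π i * (σ i / π i - 1) ^ 2 ≤
      (1 + β) * (π i * (τ i / π i - 1) ^ 2) + π i * ((1 + 1 / β) * (κ / p) ^ 2) := by
    intro i
    have h1 : |σ i / π i - τ i / π i| ≤ κ / p := by
      rw [← sub_div, abs_div, abs_of_pos (hπ i)]
      exact div_le_div₀ ((abs_nonneg _).trans (hκ i).le) (hκ i).le hp (hpπ i)
    set a := τ i / π i - 1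
    set b := σ i / π i - τ i / π i with hb
    have h2 : σ i / π i - 1 = a + b := by simp only [a, b]; ring
    have h3 : b ^ 2 ≤ (κ / p) ^ 2 := by
      rw [← sq_abs b]
      exact pow_le_pow_left₀ (abs_nonneg _) h1 2
    have h4 : (a + b) ^ 2 ≤ (1 + β) * a ^ 2 + (1 + 1 / β) * b ^ 2 := by
      have h5 : (1 + β) * a ^ 2 + (1 + 1 / β) * b ^ 2 - (a + b) ^ 2 = (β * a - b) ^ 2 / β := by
        field_simp
        ring
      have : 0 ≤ (β * a - b) ^ 2 / β := by positivity
      linarith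
    have h6 : (1 + 1 / β) * b ^ 2 ≤ (1 + 1 / β) * (κ / p) ^ 2 :=
      mul_le_mul_of_nonneg_left h3 (by positivity)
    rw [h2]
    have := mul_le_mul_of_nonneg_left (h4.trans (add_le_add_right h6 _)) (hπ i).le
    linarith
  calc chiSq π σ ≤ ∑ i, ((1 + β) * (π i * (τ i / π i - 1) ^ 2) +
        π i * ((1 + 1 / β) * (κ / p) ^ 2)) := Finset.sum_le_sum fun i _ => hi i
    _ = _ := by
      rw [Finset.sum_add_distrib, ← Finset.mul_sum, ← Finset.sum_mul, hs, one_mul, chiSq]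

/-- From every word whose signature is `χ²`-close to `π`, the random walk stays in the set of such
words with high probability. -/
theorem eventually_chiSq_stays (h : IsReversible π M) (hπ : ∀ i, 0 < π i) (h0 : 0 ≤ lam)
    (hl : lam < 1) (g : HasGap π M lam) {r η : ℝ} (hr : 0 < r) (hη : 0 < η) :
    ∀ᶠ t : ℕ in atTop, ∀ u : Fin t → Fin k, chiSq π (signature u) ≤ r →
      ∀ B : Finset (Fin t → Fin k), (∀ v, chiSq π (signature v) ≤ r → v ∈ B) →
        1 - η ≤ ∑ v ∈ B, kronPow M t u v := by
  obtain ⟨p, hp, hpπ⟩ := exists_pos_le hπ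
  set β := (1 - lam) / 2 with hβ
  have hβ0 : 0 < β := by rw [hβ]; linarith
  have hβl : (1 + β) * lam < 1 := by rw [hβ]; nlinarith
  -- The fluctuation may use up exactly what the contraction `(1 + β) lam < 1` leaves of the radius
  -- `r`.
  set A := (1 - (1 + β) * lam) * r / (1 + 1 / β) with hA
  have hA0 : 0 < A := by
    have : 0 < 1 - (1 + β) * lam := by linarith
    positivity
  set κ := p * √A with hκ
  have hκ0 : 0 < κ := by positivity
  have hκp : (κ / p) ^ 2 = A := by
    rw [hκ, mul_div_cancel_left₀ _ hp.ne', Real.sq_sqrt hA0.le]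
  filter_upwards [eventually_inv_mul_le hκ0 hη] with t ht u hu B hB
  have key := signature_concentration ht.1 (w := fun s => M (u s))
    (fun s i => h.matrix_nonneg _ _) (fun s => h.row_sum _) hκ0 B ?_
  · calc 1 - η ≤ 1 - 1 / (t * κ ^ 2) := by linarith [ht.2]
      _ ≤ _ := key
  · intro v hv
    refine hB v ?_
    have h1 := chiSq_le_of_close hπ h.sum_eq_one hp hpπ hβ0 hv
    have h2 : (fun i => (∑ s, M (u s) i) / (t : ℝ)) = signature u ᵥ* M := by
      funext i; exact sum_row_div M u i
    rw [h2, hκp] at h1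
    have h3 := chiSq_vecMul_le h hπ g (sum_signature ht.1 u)
    have h4 : (1 + 1 / β) * A = (1 - (1 + β) * lam) * r := by
      rw [hA, mul_div_cancel₀]; positivity
    have h5 : lam * chiSq π (signature u) ≤ lam * r := mul_le_mul_of_nonneg_left hu h0
    have h6 : (1 + β) * chiSq π (signature u ᵥ* M) ≤ (1 + β) * (lam * r) :=
      mul_le_mul_of_nonneg_left (h3.trans h5) (by positivity)
    rw [h4] at h1
    linarith

theorem le_one_of_sum_eq_one (hπ : ∀ i, 0 ≤ π i) (hs : ∑ i, π i = 1) (i : Fin k) : π i ≤ 1 := by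
  rw [← hs]
  exact Finset.single_le_sum (fun j _ => hπ j) (Finset.mem_univ i)

theorem lt_of_chiSq_le (hπ : ∀ i, 0 < π i) {p ε r : ℝ} (hp : 0 < p)
    (hpπ : ∀ i, p ≤ π i) (hε : 0 < ε) (hr : r < ε ^ 2 * p) {σ : Fin k → ℝ}
    (h : chiSq π σ ≤ r) (i : Fin k) : (1 - ε) * π i < σ i := by
  have h1 : π i * (σ i / π i - 1) ^ 2 ≤ r := le_trans (Finset.single_le_sum
    (f := fun i => π i * (σ i / π i - 1) ^ 2)
    (fun j _ => mul_nonneg (hπ j).le (sq_nonneg _)) (Finset.mem_univ i)) h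
  have h2 : (σ i / π i - 1) ^ 2 < ε ^ 2 := by
    have : p * (σ i / π i - 1) ^ 2 ≤ π i * (σ i / π i - 1) ^ 2 :=
      mul_le_mul_of_nonneg_right (hpπ i) (sq_nonneg _)
    nlinarith
  have h3 := (abs_lt.1 (abs_lt_of_sq_lt_sq h2 hε.le)).1
  have h4 : 1 - ε < σ i / π i := by linarith
  rwa [lt_div_iff₀ (hπ i)] at h4

theorem chiSq_le_of_lt (hπ : ∀ i, 0 < π i) (hs : ∑ i, π i = 1) {p ε : ℝ} (hp : 0 < p)
    (hpπ : ∀ i, p ≤ π i) (hε : 0 ≤ ε) {σ : Fin k → ℝ} (hσ : ∑ i, σ i = 1)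
    (h : ∀ i, (1 - ε) * π i < σ i) : chiSq π σ ≤ (ε / p) ^ 2 := by
  have hi : ∀ i, π i * (σ i / π i - 1) ^ 2 ≤ π i * (ε / p) ^ 2 := by
    intro i
    refine mul_le_mul_of_nonneg_left ?_ (hπ i).le
    have h1 : -ε ≤ σ i - π i := by
      have := h i
      have := le_one_of_sum_eq_one (fun i => (hπ i).le) hs i
      nlinarith
    -- The other coordinates have total at least `(1 - ε)(1 - π i)`, which leaves at most `π i + ε
    -- (1 - π i)` for this one.
    have h2 : σ i - π i ≤ ε := by
      have hsum : ∑ j ∈ Finset.univ.erase i, (1 - ε) * π j ≤ ∑ j ∈ Finset.univ.erase i, σ j :=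
        Finset.sum_le_sum fun j _ => (h j).le
      rw [← Finset.mul_sum] at hsum
      have e1 := Finset.add_sum_erase Finset.univ π (Finset.mem_univ i)
      have e2 := Finset.add_sum_erase Finset.univ σ (Finset.mem_univ i)
      have := hπ i
      nlinarith
    have h3 : |σ i / π i - 1| ≤ ε / p := by
      rw [div_sub_one (hπ i).ne', abs_div, abs_of_pos (hπ i)]
      exact div_le_div₀ hε (abs_le.2 ⟨h1, h2⟩) hp (hpπ i)
    rw [← sq_abs (σ i / π i - 1)]
    exact pow_le_pow_left₀ (abs_nonneg _) h3 2
  refine (Finset.sum_le_sum fun i _ => hi i).trans ?_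
  rw [← Finset.sum_mul, hs, one_mul]

end ChiSquare

/-! ### Tilting the walk towards the interior of the core -/

section Tilt

variable {k : ℕ} {π : Fin k → ℝ} {M : Matrix (Fin k) (Fin k) ℝ} {lam : ℝ}

/-- The equation `h - M² h = 1 - τ / π` has a solution bounded uniformly over the probability
vectors `τ`. -/
theorem exists_bounded_solution (h : IsReversible π M) (hπ : ∀ i, 0 < π i)
    (hl : lam < 1) (g : HasGap π M lam) :
    ∃ G : ℝ, 0 ≤ G ∧ ∀ τ : Fin k → ℝ, (∀ i, 0 ≤ τ i) → ∑ i, τ i = 1 →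
      ∃ f : Fin k → ℝ, (∀ j, |f j| ≤ G) ∧ ∀ j, f j - (M *ᵥ (M *ᵥ f)) j = 1 - τ j / π j := by
  -- Adding the mean to `1 - M²` removes its kernel, the constants. The right side `1 - τ / π` has
  -- mean zero, so the solution does too and the extra term vanishes.
  set L : (Fin k → ℝ) →ₗ[ℝ] (Fin k → ℝ) :=
    LinearMap.id - M.mulVecLin ∘ₗ M.mulVecLin +
      (LinearMap.pi fun _ => ∑ i, π i • LinearMap.proj i) with hL
  have hLa : ∀ f j, L f j = f j - (M *ᵥ (M *ᵥ f)) j + ∑ i, π i * f i := by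
    intro f j
    simp [hL]
  have hLm : ∀ f, ∑ i, π i * L f i = ∑ i, π i * f i := by
    intro f
    simp_rw [hLa, mul_add, mul_sub, Finset.sum_add_distrib, Finset.sum_sub_distrib,
      ← Finset.sum_mul, h.sum_eq_one, h.mean_mulVec]
    ring
  have hinj : Function.Injective L := by
    rw [← LinearMap.ker_eq_bot, LinearMap.ker_eq_bot']
    intro f hf
    have hm : ∑ i, π i * f i = 0 := by
      rw [← hLm, hf]; simp
    refine h.eq_zero_of_fixed hπ hl g hm ?_
    have e : f = M *ᵥ (M *ᵥ f) := by
      funext j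
      have := congrFun hf j
      rw [hLa, hm] at this
      simp only [Pi.zero_apply] at this
      linarith
    calc ∑ x, π x * f x ^ 2 = ∑ x, π x * (M *ᵥ (M *ᵥ f)) x ^ 2 := by rw [← e]
      _ ≤ _ := h.norm_mulVec_le _
  set E := (LinearEquiv.ofInjectiveEndo L hinj).symm.toContinuousLinearEquiv with hE
  set B := 1 + ∑ i, 1 / π i with hB
  have hB0 : 0 ≤ B := by
    have : ∀ i, 0 ≤ 1 / π i := fun i => one_div_nonneg.2 (hπ i).le
    have := Finset.sum_nonneg fun i (_ : i ∈ Finset.univ) => this i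
    linarith
  refine ⟨‖(E : (Fin k → ℝ) →L[ℝ] (Fin k → ℝ))‖ * B, by positivity, fun τ hτ hτs => ?_⟩
  set b : Fin k → ℝ := fun j => 1 - τ j / π j with hb
  have hbB : ‖b‖ ≤ B := by
    refine (pi_norm_le_iff_of_nonneg hB0).2 fun j => ?_
    have h1 : τ j / π j ≤ 1 / π j :=
      div_le_div_of_nonneg_right (le_one_of_sum_eq_one hτ hτs j) (hπ j).le
    have h2 : 1 / π j ≤ ∑ i, 1 / π i := Finset.single_le_sum (f := fun i => 1 / π i)
      (fun i _ => one_div_nonneg.2 (hπ i).le) (Finset.mem_univ j)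
    have h3 : 0 ≤ τ j / π j := div_nonneg (hτ j) (hπ j).le
    rw [Real.norm_eq_abs, abs_le]
    constructor <;> linarith
  have hLE : L (E b) = b := (LinearEquiv.ofInjectiveEndo L hinj).apply_symm_apply b
  have hbm : ∑ i, π i * b i = 0 := by
    have hc : ∀ x, π x * (τ x / π x) = τ x := fun x => mul_div_cancel₀ _ (hπ x).ne'
    simp_rw [hb, mul_sub, hc, mul_one, Finset.sum_sub_distrib, hτs, h.sum_eq_one, sub_self]
  refine ⟨E b, fun j => ?_, fun j => ?_⟩
  · calc |(E b) j| ≤ ‖E b‖ := norm_le_pi_norm (E b) j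
      _ ≤ ‖(E : (Fin k → ℝ) →L[ℝ] (Fin k → ℝ))‖ * ‖b‖ :=
        (E : (Fin k → ℝ) →L[ℝ] (Fin k → ℝ)).le_opNorm b
      _ ≤ _ := mul_le_mul_of_nonneg_left hbB (norm_nonneg _)
  · have h1 := hLa (E b) j
    rw [← hLm, hLE, hbm, add_zero] at h1
    exact h1.symm

theorem IsReversible.abs_mulVec_le {X : Type*} [Fintype X] {μ : X → ℝ} {M : Matrix X X ℝ}
    (h : IsReversible μ M) {f : X → ℝ} {G : ℝ} (hf : ∀ x, |f x| ≤ G) (x : X) :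
    |(M *ᵥ f) x| ≤ G := by
  calc |(M *ᵥ f) x| ≤ ∑ y, |M x y * f y| := Finset.abs_sum_le_sum_abs _ _
    _ ≤ ∑ y, M x y * G := Finset.sum_le_sum fun y _ => by
        rw [abs_mul, abs_of_nonneg (h.matrix_nonneg x y)]
        exact mul_le_mul_of_nonneg_left (hf y) (h.matrix_nonneg x y)
    _ = G := by rw [← Finset.sum_mul, h.row_sum, one_mul]

/-- If `σ ≥ (1 - e) π`, then some small perturbation of the transition matrix moves `σ` strictly
inside the region. -/
theorem exists_tilted_matrix (h : IsReversible π M) (hπ : ∀ i, 0 < π i)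
    (hl : lam < 1) (g : HasGap π M lam) {η : ℝ} (hη : 0 < η) :
    ∃ c > 0, c ≤ 1 ∧ ∀ e, 0 < e → e ≤ 1 → ∀ σ : Fin k → ℝ, ∑ i, σ i = 1 →
      (∀ i, (1 - e) * π i ≤ σ i) → ∃ K : Matrix (Fin k) (Fin k) ℝ,
        (∀ i j, 0 ≤ K i j) ∧ (∀ i, ∑ j, K i j = 1) ∧
        (∀ i j, K i j ≤ Real.exp η * M i j) ∧
        ∀ j, (1 - e) * (1 + c * e) * π j ≤ (σ ᵥ* K) j := by
  obtain ⟨G, hG0, hG⟩ := exists_bounded_solution h hπ hl g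
  -- With `|d| ≤ 2G` this keeps the tilting factor `1 + c e d` between 0 and `exp η`, and lets `e τ`
  -- absorb the errors at the end.
  set c := min 1 η / (1 + 2 * G) with hc
  have hm0 : 0 < min 1 η := lt_min one_pos hη
  have hc0 : 0 < c := by positivity
  have hc1 : c * (1 + 2 * G) = min 1 η := div_mul_cancel₀ _ (by positivity)
  have hc2 : c * (1 + 2 * G) ≤ 1 := hc1 ▸ min_le_left _ _
  have hc3 : c * (1 + 2 * G) ≤ η := hc1 ▸ min_le_right _ _
  have hcG : 0 ≤ c * G := by positivity
  refine ⟨c, hc0, by nlinarith, fun e he he1 σ hσ hσπ => ?_⟩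
  -- `σ = (1 - e) π + e ρ` with `ρ` a probability vector; untilted, coordinate `j` moves to `(1 - e)
  -- π j + e τ j`, and `τ j` may be zero.
  set ρ : Fin k → ℝ := fun i => (σ i - (1 - e) * π i) / e with hρ
  have hρ0 : ∀ i, 0 ≤ ρ i := fun i => div_nonneg (sub_nonneg.2 (hσπ i)) he.le
  have hσρ : ∀ i, σ i = (1 - e) * π i + e * ρ i := by
    intro i
    simp only [hρ]
    field_simp
    ring
  have hρs : ∑ i, ρ i = 1 := by
    simp_rw [hρ, ← Finset.sum_div, Finset.sum_sub_distrib, ← Finset.mul_sum, h.sum_eq_one, hσ]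
    rw [mul_one, sub_sub_cancel, div_self he.ne']
  set τ := ρ ᵥ* M with hτ
  have hτ0 : ∀ j, 0 ≤ τ j := fun j =>
    show 0 ≤ ∑ i, ρ i * M i j from
      Finset.sum_nonneg fun i _ => mul_nonneg (hρ0 i) (h.matrix_nonneg i j)
  have hτs : ∑ j, τ j = 1 := by
    simp only [hτ, Matrix.vecMul, dotProduct]
    rw [Finset.sum_comm]
    simp_rw [← Finset.mul_sum, h.row_sum, mul_one, hρs]
  obtain ⟨f, hfG, hf⟩ := hG τ hτ0 hτs
  -- Centring `f` under each row keeps the row sums. By reversibility the tilt of the `π` part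
  -- contributes `π j (f - M²f) j = π j - τ j`, moving mass to where `τ` is small.
  set d : Fin k → Fin k → ℝ := fun i j => f j - (M *ᵥ f) i with hd
  have hdG : ∀ i j, |d i j| ≤ 2 * G := fun i j => by
    have := abs_sub (f j) ((M *ᵥ f) i)
    have := hfG j
    have := h.abs_mulVec_le hfG i
    simp only [hd]
    linarith
  have hdl : ∀ i j, -(2 * G) ≤ d i j := fun i j => (abs_le.1 (hdG i j)).1
  have hdu : ∀ i j, d i j ≤ 2 * G := fun i j => (abs_le.1 (hdG i j)).2
  have hce : 0 < c * e := mul_pos hc0 he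
  have hceG : c * e * (1 + 2 * G) ≤ e := by nlinarith
  refine ⟨Matrix.of fun i j => M i j * (1 + c * e * d i j), ?_, ?_, ?_, ?_⟩
  · intro i j
    refine mul_nonneg (h.matrix_nonneg i j) ?_
    have := mul_le_mul_of_nonneg_left (hdl i j) hce.le
    nlinarith
  · intro i
    have e1 : ∀ j, M i j * (1 + c * e * d i j) =
        M i j + c * e * (M i j * f j) - c * e * (M *ᵥ f) i * M i j := fun j => by
      simp only [hd]; ring
    have e2 : ∑ j, M i j * f j = (M *ᵥ f) i := rfl
    simp only [Matrix.of_apply]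
    simp_rw [e1, Finset.sum_sub_distrib, Finset.sum_add_distrib, ← Finset.mul_sum, h.row_sum, e2]
    ring
  · intro i j
    rw [Matrix.of_apply, mul_comm]
    refine mul_le_mul_of_nonneg_right ?_ (h.matrix_nonneg i j)
    have h1 := mul_le_mul_of_nonneg_left (hdu i j) hce.le
    have h2 := Real.add_one_le_exp η
    nlinarith
  · intro j
    have e1 : ∀ i, σ i * (M i j * (1 + c * e * d i j)) =
        (1 - e) * (π i * M i j) + e * (ρ i * M i j) +
          c * e * (1 - e) * (π i * M i j * d i j) + c * e * e * (ρ i * M i j * d i j) := fun i => by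
      rw [hσρ]; ring
    have e2 : ∑ i, π i * M i j * d i j = π j - τ j := by
      have e3 : ∀ i, π i * M i j * d i j = f j * (π i * M i j) - π j * (M j i * (M *ᵥ f) i) :=
        fun i => by
          simp only [hd]
          linear_combination (-(M *ᵥ f) i) * h.balance i j
      have e4 : ∑ i, M j i * (M *ᵥ f) i = (M *ᵥ (M *ᵥ f)) j := rfl
      simp_rw [e3, Finset.sum_sub_distrib, ← Finset.mul_sum, h.stationary, e4]
      have := hf j
      have hj := (hπ j).ne'
      have e5 : π j * (τ j / π j) = τ j := mul_div_cancel₀ _ hj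
      linear_combination π j * this - e5
    have e5 : ∑ i, ρ i * M i j = τ j := rfl
    have e6 : -(2 * G * τ j) ≤ ∑ i, ρ i * M i j * d i j := by
      rw [← e5, Finset.mul_sum, ← Finset.sum_neg_distrib]
      refine Finset.sum_le_sum fun i _ => ?_
      have := mul_le_mul_of_nonneg_left (hdl i j) (mul_nonneg (hρ0 i) (h.matrix_nonneg i j))
      linarith
    simp only [Matrix.vecMul, dotProduct, Matrix.of_apply]
    simp_rw [e1, Finset.sum_add_distrib, ← Finset.mul_sum, h.stationary, e2, e5]
    have h1 := mul_le_mul_of_nonneg_left e6 (mul_nonneg hce.le he.le)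
    -- The `π j` terms already add up to the bound; what multiplies `τ j` is nonnegative by the
    -- choice of `c`.
    have h2 : 0 ≤ τ j * (e - c * e * (1 - e) - c * e * e * (2 * G)) := by
      refine mul_nonneg (hτ0 j) ?_
      have : c * e * e * (2 * G) ≤ c * e * (2 * G) := by
        have := mul_nonneg hcG he.le
        nlinarith
      nlinarith
    linarith

/-- From a word of the core, the random walk moves to a smaller core with probability at least
`exp(-η t) / 2`. -/
theorem eventually_core_step (h : IsReversible π M) (hπ : ∀ i, 0 < π i)
    (hl : lam < 1) (g : HasGap π M lam) {η : ℝ} (hη : 0 < η) {ε : ℝ} (hε : ε < 1) :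
    ∃ q, 0 < q ∧ q < 1 ∧ ∀ e, 0 < e → e ≤ ε → ∀ᶠ t : ℕ in atTop, ∀ u ∈ core π e t,
      ∀ B : Finset (Fin t → Fin k), (∀ v ∈ core π (q * e) t, v ∈ B) →
        Real.exp (-(η * t)) / 2 ≤ ∑ v ∈ B, kronPow M t u v := by
  rcases le_or_gt ε 0 with hε0 | hε0
  · exact ⟨1 / 2, by norm_num, by norm_num, fun e he hee => by linarith⟩
  obtain ⟨c, hc0, hc1, hc⟩ := exists_tilted_matrix h hπ hl g hη
  obtain ⟨p, hp, hpπ⟩ := exists_pos_le hπ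
  have h1ε : 0 < 1 - ε := by linarith
  -- The tilt gains at least `c e (1 - ε)`; half of it shrinks `e` to `q e` and half covers the
  -- fluctuation `κ`. The gain is positive because `ε < 1`.
  refine ⟨1 - c * (1 - ε) / 2, by nlinarith, by nlinarith [mul_pos hc0 h1ε],
    fun e he hee => ?_⟩
  set κ := e * c * (1 - ε) / 2 * p with hκ
  have hκ0 : 0 < κ := by positivity
  filter_upwards [eventually_inv_mul_le hκ0 (by norm_num : (0 : ℝ) < 1 / 2)] with t ht u hu B hB
  obtain ⟨K, hK0, hK1, hKM, hKσ⟩ := hc e he (by linarith) (signature u) (sum_signature ht.1 u)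
    fun i => (hu i).le
  have key := signature_concentration ht.1 (w := fun s => K (u s))
    (fun s i => hK0 _ _) (fun s => hK1 _) hκ0 B ?_
  -- Change of measure: each letter costs at most a factor `exp η`.
  · have h1 : ∑ v ∈ B, ∏ s, K (u s) (v s) ≤ Real.exp (η * t) * ∑ v ∈ B, kronPow M t u v := by
      rw [Finset.mul_sum]
      refine Finset.sum_le_sum fun v _ => ?_
      have : Real.exp (η * t) = ∏ _s : Fin t, Real.exp η := by
        rw [Finset.prod_const, Finset.card_univ, Fintype.card_fin, ← Real.exp_nat_mul, mul_comm]
      rw [this, kronPow, Matrix.of_apply, ← Finset.prod_mul_distrib]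
      exact Finset.prod_le_prod (fun s _ => hK0 _ _) fun s _ => hKM _ _
    have h2 : 1 / 2 ≤ Real.exp (η * t) * ∑ v ∈ B, kronPow M t u v := by linarith [ht.2]
    rw [Real.exp_neg, div_le_iff₀ two_pos, inv_le_iff_one_le_mul₀ (Real.exp_pos _)]
    linarith
  · intro v hv
    refine hB v fun i => ?_
    have h1 := (abs_lt.1 (hv i)).1
    rw [sum_row_div] at h1
    have h2 := hKσ i
    have h3 : κ ≤ e * c * (1 - ε) / 2 * π i := mul_le_mul_of_nonneg_left (hpπ i) (by positivity)
    have h4 : (1 - (1 - c * (1 - ε) / 2) * e) * π i + e * c * (1 - ε) / 2 * π i ≤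
        (1 - e) * (1 + c * e) * π i := by
      rw [← add_mul]
      refine mul_le_mul_of_nonneg_right ?_ (hπ i).le
      have : 0 ≤ c * e * (ε - e) := by
        have : 0 ≤ ε - e := by linarith
        positivity
      nlinarith
    linarith

end Tilt

/-! ### Exponential size of the core -/

section CoreSize

variable {k : ℕ} {π : Fin k → ℝ}

theorem eventually_half_le_core (hπ : ∀ i, 0 < π i) (hs : ∑ i, π i = 1) {ε : ℝ} (hε : 0 < ε) :
    ∀ᶠ t : ℕ in atTop, ∀ B : Finset (Fin t → Fin k), (∀ v ∈ core π ε t, v ∈ B) →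
      1 / 2 ≤ ∑ v ∈ B, wordWeight π t v := by
  obtain ⟨p, hp, hpπ⟩ := exists_pos_le hπ
  have hκ0 : 0 < ε * p := by positivity
  filter_upwards [eventually_inv_mul_le hκ0 (by norm_num : (0 : ℝ) < 1 / 2)] with t ht B hB
  have key := signature_concentration ht.1 (w := fun _ => π)
    (fun s i => (hπ i).le) (fun s => hs) hκ0 B ?_
  · calc (1 : ℝ) / 2 ≤ 1 - 1 / (t * (ε * p) ^ 2) := by linarith [ht.2]
      _ ≤ _ := key
  · intro v hv
    refine hB v fun i => ?_
    have htr : (t : ℝ) ≠ 0 := by have := ht.1; positivity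
    have h1 := (abs_lt.1 (hv i)).1
    rw [Finset.sum_const, Finset.card_univ, Fintype.card_fin, nsmul_eq_mul,
      mul_div_cancel_left₀ _ htr] at h1
    have := mul_le_mul_of_nonneg_left (hpπ i) hε.le
    linarith

/-- The core is exponentially large. -/
theorem eventually_log_card_core (hπ : ∀ i, 0 < π i) (hπ1 : ∀ i, π i < 1)
    (hs : ∑ i, π i = 1) {ε : ℝ} (hε : 0 < ε) :
    ∃ c > 0, ∀ᶠ t : ℕ in atTop, (core π ε t).Nonempty ∧
      c * t ≤ Real.log (Nat.card (core π ε t)) := by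
  classical
  obtain ⟨p, hp, hpπ⟩ := exists_pos_le (π := fun i => 1 - π i) fun i => sub_pos.2 (hπ1 i)
  have hne : Nonempty (Fin k) := by
    by_contra hcon
    rw [not_nonempty_iff] at hcon
    simp at hs
  obtain ⟨i₀⟩ := hne
  have hp1 : p < 1 := by linarith [hpπ i₀, hπ i₀]
  have hq0 : 0 < 1 - p := by linarith
  have hlog : Real.log (1 - p) < 0 := Real.log_neg hq0 (by linarith)
  -- The core has mass at least 1/2 and no word weighs more than `(1 - p)^t`; halving the rate
  -- absorbs `log 2`.
  refine ⟨-Real.log (1 - p) / 2, by linarith, ?_⟩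
  filter_upwards [eventually_half_le_core hπ hs hε,
    tendsto_natCast_atTop_atTop.eventually_ge_atTop (2 * Real.log 2 / (-Real.log (1 - p)))]
    with t ht htl
  have h1 := ht (core π ε t).toFinset fun v hv => Set.mem_toFinset.2 hv
  have hcard : Nat.card (core π ε t) = (core π ε t).toFinset.card := by
    rw [Nat.card_eq_fintype_card, Set.toFinset_card]
  have hw : ∀ v : Fin t → Fin k, wordWeight π t v ≤ (1 - p) ^ t := by
    intro v
    calc wordWeight π t v ≤ ∏ _s : Fin t, (1 - p) :=
          Finset.prod_le_prod (fun s _ => (hπ _).le) fun s _ => by linarith [hpπ (v s)]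
      _ = _ := by simp
  have h2 : 1 / 2 ≤ (Nat.card (core π ε t) : ℝ) * (1 - p) ^ t := by
    rw [hcard, ← nsmul_eq_mul]
    exact h1.trans (Finset.sum_le_card_nsmul _ _ _ fun v _ => hw v)
  have hpos : (0 : ℝ) < Nat.card (core π ε t) := by
    by_contra hcon
    have : (Nat.card (core π ε t) : ℝ) = 0 :=
      le_antisymm (not_lt.1 hcon) (Nat.cast_nonneg _)
    rw [this] at h2
    norm_num at h2
  constructor
  · by_contra hcon
    rw [Set.not_nonempty_iff_eq_empty] at hcon
    simp [hcon] at hpos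
  · have h3 := Real.log_le_log (by norm_num) h2
    rw [Real.log_mul hpos.ne' (by positivity), Real.log_pow, one_div, Real.log_inv] at h3
    rw [div_le_iff₀ (by linarith)] at htl
    linarith

end CoreSize

/-! ### Union bounds for missing edges -/

section Probability

variable {k : ℕ} {P : Matrix (Fin k) (Fin k) ℝ} (hP : P.IsSymm)
  (h01 : ∀ i j, P i j ∈ Set.Icc (0 : ℝ) 1) {t : ℕ}

instance : IsProbabilityMeasure (law P hP h01 t) := by
  unfold law; infer_instance

/-- The probability that there is no edge between two disjoint sets of words. -/
theorem law_no_edge_le (S U : Finset (Fin t → Fin k)) (hSU : Disjoint S U) :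
    (law P hP h01 t).real {ω | ∀ u ∈ S, ∀ v ∈ U, ω s(u, v) = false} ≤
      Real.exp (-∑ u ∈ S, ∑ v ∈ U, kronPow P t u v) := by
  classical
  set F : Finset (Sym2 (Fin t → Fin k)) := (S ×ˢ U).image fun p => s(p.1, p.2) with hF
  have hset : {ω : Sym2 (Fin t → Fin k) → Bool | ∀ u ∈ S, ∀ v ∈ U, ω s(u, v) = false} =
      Set.univ.pi fun e => if e ∈ F then {false} else Set.univ := by
    ext ω
    simp only [Set.mem_ofPred_eq, Set.mem_univ_pi]
    constructor
    · intro h e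
      split_ifs with he
      · obtain ⟨p, hp, rfl⟩ := Finset.mem_image.1 he
        exact h _ (Finset.mem_product.1 hp).1 _ (Finset.mem_product.1 hp).2
      · trivial
    · intro h u hu v hv
      have he : s(u, v) ∈ F :=
        Finset.mem_image.2 ⟨(u, v), Finset.mem_product.2 ⟨hu, hv⟩, rfl⟩
      have := h s(u, v)
      rwa [if_pos he] at this
  -- Disjointness of `S` and `U` ensures that no unordered pair is counted twice.
  have hinj : Set.InjOn (fun p : (Fin t → Fin k) × (Fin t → Fin k) => s(p.1, p.2))
      (S ×ˢ U : Finset _) := by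
    rintro ⟨a, b⟩ hab ⟨c, d⟩ hcd h
    simp only [Finset.coe_product, Set.mem_prod, Finset.mem_coe] at hab hcd
    rcases Sym2.eq_iff.1 h with ⟨rfl, rfl⟩ | ⟨rfl, rfl⟩
    · rfl
    · exact (Finset.disjoint_left.1 hSU hab.1 hcd.2).elim
  have hfac : ∀ e, (ProbabilityTheory.bernoulliMeasure true false (edgeProb P hP h01 t e)).real
      (if e ∈ F then {false} else Set.univ) =
      if e ∈ F then 1 - (edgeProb P hP h01 t e : ℝ) else 1 := by
    intro e
    split_ifs with he
    · rw [ProbabilityTheory.bernoulliMeasure_real_apply_of_notMem_of_mem _ (by simp) (by simp)]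
      simp
    · simp
  rw [hset, law, measureReal_def, Measure.pi_pi, ENNReal.toReal_prod]
  simp only [← measureReal_def]
  simp_rw [hfac]
  rw [Finset.prod_ite_mem, Finset.univ_inter, hF, Finset.prod_image hinj, Finset.prod_product,
    ← Finset.sum_neg_distrib, Real.exp_sum]
  refine Finset.prod_le_prod (fun u _ => Finset.prod_nonneg fun v _ =>
    sub_nonneg.2 (edgeProb P hP h01 t _).2.2) fun u _ => ?_
  rw [← Finset.sum_neg_distrib, Real.exp_sum]
  exact Finset.prod_le_prod (fun v _ => sub_nonneg.2 (edgeProb P hP h01 t _).2.2)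
    fun v _ => Real.one_sub_le_exp_neg _

/-- Every word of `L` has a neighbour in `L'`, up to a small probability. -/
theorem law_no_neighbour_le (L L' : Finset (Fin t → Fin k)) {y : ℝ}
    (hy : ∀ u ∈ L, y ≤ ∑ v ∈ L', kronPow P t u v) :
    (law P hP h01 t).real {ω | ∃ u ∈ L, ∀ v ∈ L', v ≠ u → ω s(u, v) = false} ≤
      (k : ℝ) ^ t * Real.exp (1 - y) := by
  classical
  have hsub : {ω : Sym2 (Fin t → Fin k) → Bool |
      ∃ u ∈ L, ∀ v ∈ L', v ≠ u → ω s(u, v) = false} ⊆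
      ⋃ u ∈ L, {ω | ∀ a ∈ ({u} : Finset (Fin t → Fin k)), ∀ v ∈ L'.erase u,
        ω s(a, v) = false} := by
    rintro ω ⟨u, hu, h⟩
    refine Set.mem_biUnion (x := u) hu fun a ha v hv => ?_
    rw [Finset.mem_singleton.1 ha]
    exact h v (Finset.mem_of_mem_erase hv) (Finset.ne_of_mem_erase hv)
  refine (measureReal_mono hsub (measure_ne_top _ _)).trans ((measureReal_biUnion_finset_le _ _).trans ?_)
  have hb : ∀ u ∈ L, (law P hP h01 t).real {ω | ∀ a ∈ ({u} : Finset (Fin t → Fin k)),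
      ∀ v ∈ L'.erase u, ω s(a, v) = false} ≤ Real.exp (1 - y) := by
    intro u hu
    refine (law_no_edge_le hP h01 {u} (L'.erase u)
      (Finset.disjoint_singleton_left.2 (Finset.notMem_erase u L'))).trans ?_
    refine Real.exp_le_exp.2 ?_
    rw [Finset.sum_singleton]
    -- Discarding the loop at `u` loses at most 1, whence `exp (1 - y)`.
    have h1 : ∑ v ∈ L', kronPow P t u v ≤ 1 + ∑ v ∈ L'.erase u, kronPow P t u v := by
      by_cases hm : u ∈ L'
      · rw [← Finset.add_sum_erase _ _ hm]
        exact add_le_add_left (kronPow_mem h01 t u u).2 _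
      · rw [Finset.erase_eq_of_notMem hm]
        linarith
    linarith [hy u hu]
  refine (Finset.sum_le_card_nsmul _ _ _ hb).trans ?_
  rw [nsmul_eq_mul]
  refine mul_le_mul_of_nonneg_right ?_ (Real.exp_pos _).le
  have : L.card ≤ k ^ t := by
    simpa using Finset.card_le_univ L
  exact_mod_cast this

/-- A union bound over all pairs `S ⊆ T` of sets of words: up to a small probability, every
admissible `S` has an edge to a vertex of `D` outside `T`. -/
theorem law_no_expansion_le (D : Finset (Fin t → Fin k))
    (A : Finset (Fin t → Fin k) → Finset (Fin t → Fin k) → Prop) {y : ℝ}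
    (hA : ∀ S T, A S T → S ⊆ T ∧ T.Nonempty ∧
      y * T.card ≤ ∑ u ∈ S, ∑ v ∈ D.filter (· ∉ T), kronPow P t u v)
    (hy : 2 * (k : ℝ) ^ t * Real.exp (-y) ≤ 1) :
    (law P hP h01 t).real
      {ω | ∃ S T, A S T ∧ ∀ u ∈ S, ∀ v ∈ D.filter (· ∉ T), ω s(u, v) = false} ≤
      4 * ((k : ℝ) ^ t * Real.exp (-y)) := by
  classical
  set I : Finset (Finset (Fin t → Fin k)) := Finset.univ.erase ∅ with hI
  have hsub : {ω : Sym2 (Fin t → Fin k) → Bool |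
      ∃ S T, A S T ∧ ∀ u ∈ S, ∀ v ∈ D.filter (· ∉ T), ω s(u, v) = false} ⊆
      ⋃ T ∈ I, ⋃ S ∈ T.powerset.filter (A · T),
        {ω | ∀ u ∈ S, ∀ v ∈ D.filter (· ∉ T), ω s(u, v) = false} := by
    rintro ω ⟨S, T, hST, h⟩
    obtain ⟨h1, h2, -⟩ := hA S T hST
    refine Set.mem_biUnion (x := T) ?_ (Set.mem_biUnion (x := S) ?_ h)
    · exact Finset.mem_erase.2 ⟨h2.ne_empty, Finset.mem_univ T⟩
    · exact Finset.mem_filter.2 ⟨Finset.mem_powerset.2 h1, hST⟩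
  refine (measureReal_mono hsub (measure_ne_top _ _)).trans ((measureReal_biUnion_finset_le _ _).trans ?_)
  -- Each `T` has `2^|T|` subsets `S`, each failing with probability at most `exp (-y |T|)`; summing
  -- `x^|T|` over nonempty `T` is then a binomial expansion.
  set x := 2 * Real.exp (-y) with hx
  have hx0 : 0 < x := by positivity
  have hT : ∀ T ∈ I, (law P hP h01 t).real (⋃ S ∈ T.powerset.filter (A · T),
      {ω | ∀ u ∈ S, ∀ v ∈ D.filter (· ∉ T), ω s(u, v) = false}) ≤ x ^ T.card := by
    intro T _
    refine (measureReal_biUnion_finset_le _ _).trans ?_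
    have hb : ∀ S ∈ T.powerset.filter (A · T), (law P hP h01 t).real
        {ω | ∀ u ∈ S, ∀ v ∈ D.filter (· ∉ T), ω s(u, v) = false} ≤
          Real.exp (-(y * T.card)) := by
      intro S hS
      obtain ⟨h1, h2, h3⟩ := hA S T (Finset.mem_filter.1 hS).2
      refine (law_no_edge_le hP h01 _ _ ?_).trans (Real.exp_le_exp.2 (neg_le_neg h3))
      exact Finset.disjoint_left.2 fun u hu hu' => (Finset.mem_filter.1 hu').2 (h1 hu)
    refine (Finset.sum_le_card_nsmul _ _ _ hb).trans ?_
    rw [nsmul_eq_mul, hx, mul_pow, ← Real.exp_nat_mul]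
    have e : (T.card : ℝ) * -y = -(y * T.card) := by ring
    rw [e]
    refine mul_le_mul_of_nonneg_right ?_ (Real.exp_pos _).le
    have := (Finset.card_filter_le T.powerset (A · T)).trans (Finset.card_powerset T).le
    exact_mod_cast this
  refine (Finset.sum_le_sum hT).trans ?_
  have hsum : ∑ T ∈ I, x ^ T.card = (x + 1) ^ (k ^ t) - 1 := by
    have h1 := Fintype.sum_pow_mul_eq_add_pow (Fin t → Fin k) x 1
    simp only [one_pow, mul_one, Fintype.card_fun, Fintype.card_fin] at h1
    rw [← h1, ← Finset.add_sum_erase _ _ (Finset.mem_univ (∅ : Finset (Fin t → Fin k)))]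
    simp [hI]
  rw [hsum]
  have h1 : (x + 1) ^ (k ^ t) ≤ Real.exp ((k : ℝ) ^ t * x) := by
    calc (x + 1) ^ (k ^ t) ≤ Real.exp x ^ (k ^ t) :=
          pow_le_pow_left₀ (by positivity) (Real.add_one_le_exp x) _
      _ = _ := by rw [← Real.exp_nat_mul]; push_cast; rfl
  have hn : 0 ≤ (k : ℝ) ^ t * x := by positivity
  -- `e^z - 1 ≤ 2z` for `0 ≤ z ≤ 1`, with `z = k^t x`; the two factors 2 make the constant 4.
  have h2 := Real.abs_exp_sub_one_le (x := (k : ℝ) ^ t * x) (by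
    rw [abs_of_nonneg hn, hx]; linarith)
  rw [abs_of_nonneg hn] at h2
  have h3 := le_abs_self (Real.exp ((k : ℝ) ^ t * x) - 1)
  rw [hx] at *
  linarith

end Probability

/-! ### Deterministic growth of balls and the diameter -/

section Graph

/-- The vertices of `D` at distance at most `r` from `x` in the induced graph. -/
noncomputable def inducedBall {V : Type} (G : SimpleGraph V) (C : Set V) (D : Finset V) (x : C)
    (r : ℕ) : Finset V :=
  open Classical in D.filter fun v => ∃ h : v ∈ C, (G.induce C).edist x ⟨v, h⟩ ≤ r

theorem mem_inducedBall {V : Type} {G : SimpleGraph V} {C : Set V} {D : Finset V} {x : C} {r : ℕ}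
    {v : V} :
    v ∈ inducedBall G C D x r ↔ v ∈ D ∧ ∃ h : v ∈ C, (G.induce C).edist x ⟨v, h⟩ ≤ r := by
  simp [inducedBall]

theorem edist_induce_succ_le {V : Type} {G : SimpleGraph V} {C : Set V} {x : C} {r : ℕ} {u v : V} (hu : u ∈ C) (hv : v ∈ C)
    (hr : (G.induce C).edist x ⟨u, hu⟩ ≤ r) (huv : G.Adj u v) :
    (G.induce C).edist x ⟨v, hv⟩ ≤ (r + 1 : ℕ) := by
  have h1 : (G.induce C).Adj ⟨u, hu⟩ ⟨v, hv⟩ := huv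
  refine ((G.induce C).edist_triangle (v := ⟨u, hu⟩)).trans ?_
  rw [SimpleGraph.edist_eq_one_iff_adj.2 h1, Nat.cast_add, Nat.cast_one]
  exact add_le_add_left hr 1

/-- If every small subset of `D` expands inside `D`, the balls grow geometrically until they
contain more than half of the total weight. -/
theorem inducedBall_growth {V : Type} {G : SimpleGraph V} {C : Set V} {D : Finset V} {μ : V → ℝ} (hμ : ∀ v, 0 ≤ μ v) {γ : ℝ} (hγ : 0 ≤ γ)
    (hDC : ∀ v ∈ D, v ∈ C)
    (hexp : ∀ S T : Finset V, S ⊆ T → T ⊆ D → S.Nonempty → ∑ v ∈ S, μ v ≤ 1 / 2 →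
      ∑ v ∈ T, μ v ≤ (1 + γ) * ∑ v ∈ S, μ v → ∃ u ∈ S, ∃ v ∈ D, v ∉ T ∧ G.Adj u v)
    (x : C) (hx : x.1 ∈ D) (r : ℕ) :
    1 / 2 < ∑ v ∈ inducedBall G C D x r, μ v ∨
      (1 + γ) ^ r * μ x ≤ ∑ v ∈ inducedBall G C D x r, μ v := by
  have hmono : ∀ r, inducedBall G C D x r ⊆ inducedBall G C D x (r + 1) := by
    intro r v hv
    obtain ⟨h1, h2, h3⟩ := mem_inducedBall.1 hv
    exact mem_inducedBall.2 ⟨h1, h2, h3.trans (by exact_mod_cast Nat.le_succ r)⟩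
  have hself : ∀ r, x.1 ∈ inducedBall G C D x r := fun r =>
    mem_inducedBall.2 ⟨hx, x.2, by simp⟩
  induction r with
  | zero =>
    right
    rw [pow_zero, one_mul]
    exact Finset.single_le_sum (fun v _ => hμ v) (hself 0)
  | succ r ih =>
    have hle : ∑ v ∈ inducedBall G C D x r, μ v ≤ ∑ v ∈ inducedBall G C D x (r + 1), μ v :=
      Finset.sum_le_sum_of_subset_of_nonneg (hmono r) fun v _ _ => hμ v
    by_cases hhalf : 1 / 2 < ∑ v ∈ inducedBall G C D x r, μ v
    · exact Or.inl (hhalf.trans_le hle)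
    · right
      have hr := ih.resolve_left hhalf
      by_contra hcon
      have hT : ∑ v ∈ inducedBall G C D x (r + 1), μ v ≤
          (1 + γ) * ∑ v ∈ inducedBall G C D x r, μ v := by
        refine (not_le.1 hcon).le.trans ?_
        rw [pow_succ', mul_assoc]
        exact mul_le_mul_of_nonneg_left hr (by linarith)
      -- Take `S` and `T` to be consecutive balls: an edge from `S` into `D \ T` contradicts the
      -- definition of the larger ball.
      obtain ⟨u, hu, v, hv, hvT, huv⟩ := hexp _ _ (hmono r)
        (fun v hv => (mem_inducedBall.1 hv).1) ⟨x.1, hself r⟩ (not_lt.1 hhalf) hT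
      obtain ⟨-, h2, h3⟩ := mem_inducedBall.1 hu
      exact hvT (mem_inducedBall.2 ⟨hv, hDC v hv, edist_induce_succ_le h2 (hDC v hv) h3 huv⟩)

variable {V : Type} [Fintype V] [DecidableEq V] {G : SimpleGraph V} {C : Set V} {D : Finset V}

/-- Two balls of mass above one half cannot be disjoint. -/
theorem edist_le_of_expansion {μ : V → ℝ} (hμ : ∀ v, 0 ≤ μ v) (hμ1 : ∑ v, μ v = 1)
    {γ : ℝ} (hγ : 0 ≤ γ) (hDC : ∀ v ∈ D, v ∈ C)
    (hexp : ∀ S T : Finset V, S ⊆ T → T ⊆ D → S.Nonempty → ∑ v ∈ S, μ v ≤ 1 / 2 →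
      ∑ v ∈ T, μ v ≤ (1 + γ) * ∑ v ∈ S, μ v → ∃ u ∈ S, ∃ v ∈ D, v ∉ T ∧ G.Adj u v)
    {r : ℕ} (hr : ∀ v ∈ D, 1 / 2 < (1 + γ) ^ r * μ v)
    (x y : C) (hx : x.1 ∈ D) (hy : y.1 ∈ D) : (G.induce C).edist x y ≤ (r + r : ℕ) := by
  have hball : ∀ x : C, x.1 ∈ D → 1 / 2 < ∑ v ∈ inducedBall G C D x r, μ v := fun x hx =>
    (inducedBall_growth hμ hγ hDC hexp x hx r).elim id fun h => (hr x hx).trans_le h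
  have hmeet : ¬ Disjoint (inducedBall G C D x r) (inducedBall G C D y r) := by
    intro hd
    have h1 := Finset.sum_union (f := μ) hd
    have h2 : ∑ v ∈ inducedBall G C D x r ∪ inducedBall G C D y r, μ v ≤ 1 := by
      rw [← hμ1]
      exact Finset.sum_le_sum_of_subset_of_nonneg (Finset.subset_univ _) fun v _ _ => hμ v
    linarith [hball x hx, hball y hy]
  obtain ⟨z, hzx, hzy⟩ := Finset.not_disjoint_iff.1 hmeet
  obtain ⟨-, hz, h1⟩ := mem_inducedBall.1 hzx
  obtain ⟨-, _, h2⟩ := mem_inducedBall.1 hzy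
  refine ((G.induce C).edist_triangle (v := ⟨z, hz⟩)).trans ?_
  rw [Nat.cast_add]
  exact add_le_add h1 (by rwa [SimpleGraph.edist_comm])

/-- A graph in which a set `D` expands and every vertex of `C` is joined to `D` by a short chain
of levels has small diameter. -/
theorem connected_and_diam_le {μ : V → ℝ} (hμ : ∀ v, 0 ≤ μ v) (hμ1 : ∑ v, μ v = 1)
    {γ : ℝ} (hγ : 0 ≤ γ) (hDC : ∀ v ∈ D, v ∈ C)
    (hexp : ∀ S T : Finset V, S ⊆ T → T ⊆ D → S.Nonempty → ∑ v ∈ S, μ v ≤ 1 / 2 →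
      ∑ v ∈ T, μ v ≤ (1 + γ) * ∑ v ∈ S, μ v → ∃ u ∈ S, ∃ v ∈ D, v ∉ T ∧ G.Adj u v)
    {r : ℕ} (hr : ∀ v ∈ D, 1 / 2 < (1 + γ) ^ r * μ v) (hne : C.Nonempty)
    {m : ℕ} {L : ℕ → Finset V} (hL0 : ∀ v ∈ C, v ∈ L 0) (hLC : ∀ j, ∀ v ∈ L j, v ∈ C)
    (hLD : L m ⊆ D) (hstep : ∀ j < m, ∀ u ∈ L j, ∃ v ∈ L (j + 1), G.Adj u v) :
    (G.induce C).Connected ∧ (G.induce C).diam ≤ 2 * m + 2 * r := by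
  have hreach : ∀ x : C, ∀ j ≤ m, ∃ v ∈ L j, ∃ h : v ∈ C, (G.induce C).edist x ⟨v, h⟩ ≤ j := by
    intro x j
    induction j with
    | zero => exact fun _ => ⟨x, hL0 x x.2, x.2, by simp⟩
    | succ j ih =>
      intro hj
      obtain ⟨u, hu, huC, hd⟩ := ih (by omega)
      obtain ⟨v, hv, huv⟩ := hstep j (by omega) u hu
      exact ⟨v, hv, hLC _ v hv, edist_induce_succ_le huC (hLC _ v hv) hd huv⟩
  have hdist : ∀ x y : C, (G.induce C).edist x y ≤ (2 * m + 2 * r : ℕ) := by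
    intro x y
    obtain ⟨a, ha, haC, hxa⟩ := hreach x m le_rfl
    obtain ⟨b, hb, hbC, hyb⟩ := hreach y m le_rfl
    have hab := edist_le_of_expansion hμ hμ1 hγ hDC hexp hr ⟨a, haC⟩ ⟨b, hbC⟩ (hLD ha) (hLD hb)
    rw [SimpleGraph.edist_comm] at hyb
    have e : (2 * m + 2 * r : ℕ) = m + ((r + r : ℕ) + m) := by ring
    rw [e, Nat.cast_add, Nat.cast_add (r + r)]
    exact ((G.induce C).edist_triangle (v := ⟨a, haC⟩)).trans (add_le_add hxa
      (((G.induce C).edist_triangle (v := ⟨b, hbC⟩)).trans (add_le_add hab hyb)))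
  have := hne.to_subtype
  -- The bound is on the extended diameter, whose finiteness gives connectedness; `diam` alone would
  -- be 0 at infinite diameter.
  have hediam : (G.induce C).ediam ≤ (2 * m + 2 * r : ℕ) :=
    SimpleGraph.ediam_le_of_edist_le hdist
  have hfin : (G.induce C).ediam ≠ ⊤ := ne_top_of_le_ne_top (ENat.natCast_ne_top _) hediam
  exact ⟨SimpleGraph.connected_of_ediam_ne_top hfin, ENat.toNat_le_of_le_natCast hediam⟩

end Graph

/-! ### Expansion inside a set the chain rarely leaves -/

/-- If the chain rarely leaves `D`, then small subsets of `D` have a large flow into `D`, even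
after removing slightly larger sets. -/
theorem IsReversible.expansion {X : Type*} [Fintype X] [DecidableEq X] {μ : X → ℝ}
    {M : Matrix X X ℝ} (h : IsReversible μ M) {lam : ℝ} (hg : HasGap μ M lam) (h0 : 0 ≤ lam)
    (hl : lam < 1) {D S T : Finset X}
    (hleak : ∀ u ∈ D, 1 - (1 - lam) / 16 ≤ ∑ v ∈ D, M u v)
    (hST : S ⊆ T) (hTD : T ⊆ D) (hS : ∑ v ∈ S, μ v ≤ 1 / 2)
    (hT : ∑ v ∈ T, μ v ≤ (1 + (1 - lam) / 16) * ∑ v ∈ S, μ v) :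
    (1 - lam) / 16 * ∑ v ∈ T, μ v ≤ ∑ u ∈ S, ∑ v ∈ D.filter (· ∉ T), μ u * M u v := by
  set γ := (1 - lam) / 16 with hγ
  set s := ∑ v ∈ S, μ v with hs
  have hs0 : 0 ≤ s := Finset.sum_nonneg fun v _ => h.nonneg v
  have hcut := h.cut hg S
  have hQ0 : ∀ u v, 0 ≤ μ u * M u v := fun u v => mul_nonneg (h.nonneg u) (h.matrix_nonneg u v)
  -- Flow leaving `S` reaches `D \ T`, escapes `D`, or lands in the thin layer `T \ S`; the last two
  -- carry at most `γ s` each.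
  have hcover : Sᶜ ⊆ D.filter (· ∉ T) ∪ (Dᶜ ∪ T \ S) := by
    intro v hv
    simp only [Finset.mem_union, Finset.mem_filter, Finset.mem_compl, Finset.mem_sdiff] at hv ⊢
    tauto
  have hsplit : ∀ u, ∑ v ∈ Sᶜ, μ u * M u v ≤ ∑ v ∈ D.filter (· ∉ T), μ u * M u v +
      (∑ v ∈ Dᶜ, μ u * M u v + ∑ v ∈ T \ S, μ u * M u v) := by
    intro u
    have hun : ∀ A B : Finset X, ∑ v ∈ A ∪ B, μ u * M u v ≤
        ∑ v ∈ A, μ u * M u v + ∑ v ∈ B, μ u * M u v := by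
      intro A B
      rw [← Finset.sum_union_inter]
      exact le_add_of_nonneg_right (Finset.sum_nonneg fun v _ => hQ0 u v)
    exact (Finset.sum_le_sum_of_subset_of_nonneg hcover fun v _ _ => hQ0 u v).trans
      ((hun _ _).trans (add_le_add_right (hun _ _) _))
  have h1 : ∑ u ∈ S, ∑ v ∈ Dᶜ, μ u * M u v ≤ γ * s := by
    rw [hs, Finset.mul_sum]
    refine Finset.sum_le_sum fun u hu => ?_
    rw [← Finset.mul_sum, mul_comm]
    refine mul_le_mul_of_nonneg_right ?_ (h.nonneg u)
    have := hleak u (hTD (hST hu))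
    have e := Finset.sum_add_sum_compl D (M u)
    rw [h.row_sum] at e
    linarith
  have h2 : ∑ u ∈ S, ∑ v ∈ T \ S, μ u * M u v ≤ γ * s := by
    calc ∑ u ∈ S, ∑ v ∈ T \ S, μ u * M u v
        ≤ ∑ u, ∑ v ∈ T \ S, μ u * M u v := Finset.sum_le_sum_of_subset_of_nonneg
          (Finset.subset_univ S) fun u _ _ => Finset.sum_nonneg fun v _ => hQ0 u v
      _ = ∑ v ∈ T \ S, μ v := by
          rw [Finset.sum_comm]
          exact Finset.sum_congr rfl fun v _ => h.stationary v
      _ ≤ γ * s := by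
          have := Finset.sum_sdiff (f := μ) hST
          linarith
  have h3 := Finset.sum_le_sum fun u (_ : u ∈ S) => hsplit u
  rw [Finset.sum_add_distrib, Finset.sum_add_distrib] at h3
  -- As `s ≤ 1/2`, the cut is at least `4γs`; the two losses leave `2γs`, which dominates `γ` times
  -- the mass of `T` since `T` weighs at most `2s`.
  have h4 : 4 * γ * s ≤ (1 - lam) / 2 * (s * (1 - s)) := by
    have : 0 ≤ s * (1 / 2 - s) := mul_nonneg hs0 (by linarith)
    rw [hγ]
    nlinarith
  have h5 : γ * ∑ v ∈ T, μ v ≤ γ * (2 * s) := by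
    refine mul_le_mul_of_nonneg_left ?_ (by rw [hγ]; linarith)
    have : γ * s ≤ 1 * s := mul_le_mul_of_nonneg_right (by rw [hγ]; linarith) hs0
    linarith
  linarith

/-! ### Descent from the core to the `χ²` ball -/

section Levels

variable {k : ℕ} {P : Matrix (Fin k) (Fin k) ℝ}

theorem core_subset_core {π : Fin k → ℝ} (hπ : ∀ i, 0 < π i) {e ε : ℝ} (he : e ≤ ε) (t : ℕ) :
    core π e t ⊆ core π ε t := fun v hv i =>
  lt_of_le_of_lt (mul_le_mul_of_nonneg_right (by linarith) (hπ i).le) (hv i)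

theorem core_eq_univ {π : Fin k → ℝ} (hπ : ∀ i, 0 < π i) {ε : ℝ} (hε : 1 < ε) (t : ℕ) :
    core π ε t = Set.univ :=
  Set.eq_univ_of_forall fun v i =>
    lt_of_lt_of_le (mul_neg_of_neg_of_pos (by linarith) (hπ i)) (signature_nonneg v i)

/-- The core is connected by boundedly many steps of exponentially large degree to a set `D` which
the random walk rarely leaves. -/
theorem exists_levels [Nonempty (Fin k)] (hc : ∀ i, 0 < colSum P i)
    {lam : ℝ} (h : IsReversible (fun i => colSum P i / vol P) (walkMatrix P))
    (h0 : 0 ≤ lam) (hl : lam < 1) (g : HasGap (fun i => colSum P i / vol P) (walkMatrix P) lam)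
    {ε : ℝ} (hε0 : 0 < ε) (hε1 : ε ≠ 1) {δ : ℝ} (hδ : 0 < δ)
    (hdeg : ∀ t : ℕ, 0 < t → ∀ u ∈ core (fun i => colSum P i / vol P) ε t,
      Real.exp (δ * t) ≤ wordWeight (colSum P) t u)
    {ξ : ℝ} (hξ : 0 < ξ) :
    ∃ (m : ℕ) (D : ∀ t, Set (Fin t → Fin k)) (L : ∀ t, ℕ → Set (Fin t → Fin k)),
      ∀ᶠ t : ℕ in atTop, D t ⊆ core (fun i => colSum P i / vol P) ε t ∧
        core (fun i => colSum P i / vol P) ε t ⊆ L t 0 ∧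
        (∀ j, L t j ⊆ core (fun i => colSum P i / vol P) ε t) ∧ L t m ⊆ D t ∧
        (∀ j < m, ∀ u ∈ L t j, ∀ B : Finset (Fin t → Fin k), (∀ v ∈ L t (j + 1), v ∈ B) →
          Real.exp (δ / 2 * t) ≤ ∑ v ∈ B, kronPow P t u v) ∧
        (∀ u ∈ D t, ∀ B : Finset (Fin t → Fin k), (∀ v ∈ D t, v ∈ B) →
          1 - ξ ≤ ∑ v ∈ B, kronPow (walkMatrix P) t u v) := by
  have hv : 0 < vol P := Finset.sum_pos (fun i _ => hc i) Finset.univ_nonempty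
  set π : Fin k → ℝ := fun i => colSum P i / vol P with hπdef
  have hπ : ∀ i, 0 < π i := fun i => div_pos (hc i) hv
  rcases lt_or_gt_of_ne hε1 with hε | hε
  · obtain ⟨p, hp, hpπ⟩ := exists_pos_le hπ
    -- With `η = δ/4` the product of degree and step probability is at least `e^(3δt/4) / 2`, hence
    -- at least `e^(δt/2)` for large `t`.
    obtain ⟨q, hq0, hq1, hq⟩ := eventually_core_step h hπ hl g (η := δ / 4) (by linarith) hε
    set r := ε ^ 2 * p / 2 with hr
    have hr0 : 0 < r := by positivity
    have hrlt : r < ε ^ 2 * p := by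
      have : 0 < ε ^ 2 * p := by positivity
      rw [hr]; linarith
    -- The number of levels is fixed by `q^m → 0` and does not depend on `t`.
    obtain ⟨m, hm⟩ : ∃ m : ℕ, (q ^ m * ε / p) ^ 2 ≤ r := by
      have : Tendsto (fun m : ℕ => (q ^ m * ε / p) ^ 2) atTop (nhds ((0 * ε / p) ^ 2)) :=
        (((tendsto_pow_atTop_nhds_zero_of_lt_one hq0.le hq1).mul_const ε).div_const p).pow 2
      rw [zero_mul, zero_div, zero_pow two_ne_zero] at this
      exact ((this.eventually_lt_const hr0).exists).imp fun _ h => h.le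
    have hqj : ∀ j : ℕ, q ^ j * ε ≤ ε := fun j =>
      mul_le_of_le_one_left hε0.le (pow_le_one₀ hq0.le hq1.le)
    have hqp : ∀ j : ℕ, 0 < q ^ j * ε := fun j => by positivity
    refine ⟨m, fun t => {v | chiSq π (signature v) ≤ r}, fun t j => core π (q ^ j * ε) t, ?_⟩
    have hsteps : ∀ᶠ t : ℕ in atTop, ∀ j ∈ Finset.range m, ∀ u ∈ core π (q ^ j * ε) t,
        ∀ B : Finset (Fin t → Fin k), (∀ v ∈ core π (q * (q ^ j * ε)) t, v ∈ B) →
          Real.exp (-(δ / 4 * t)) / 2 ≤ ∑ v ∈ B, kronPow (walkMatrix P) t u v :=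
      (Finset.eventually_all _).2 fun j _ => hq _ (hqp j) (hqj j)
    filter_upwards [hsteps, eventually_chiSq_stays h hπ h0 hl g hr0 hξ, eventually_gt_atTop 0,
      tendsto_natCast_atTop_atTop.eventually_ge_atTop (4 / δ)] with t hst hstay ht0 ht
    refine ⟨fun v hv i => lt_of_chiSq_le hπ hp hpπ hε0 hrlt hv i, by simp,
      fun j => core_subset_core hπ (hqj j) t, fun v hv => ?_, ?_, fun u hu B hB => hstay u hu B hB⟩
    · exact (chiSq_le_of_lt hπ h.sum_eq_one hp hpπ (hqp m).le (sum_signature ht0 v) hv).trans hm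
    · intro j hj u hu B hB
      have h1 := hst j (Finset.mem_range.2 hj) u hu B (by
        have e : q * (q ^ j * ε) = q ^ (j + 1) * ε := by ring
        rw [e]; exact hB)
      have h2 := hdeg t ht0 u (core_subset_core hπ (hqj j) t hu)
      simp_rw [kronPow_eq_mul_walk hc, ← Finset.mul_sum]
      refine le_trans ?_ (mul_le_mul h2 h1 (by positivity) ((Real.exp_pos _).le.trans h2))
      rw [← mul_div_assoc, ← Real.exp_add, le_div_iff₀ two_pos]
      have h3 : (2 : ℝ) ≤ Real.exp (δ / 4 * t) := by
        have h4 := Real.add_one_le_exp (δ / 4 * t)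
        rw [div_le_iff₀ hδ] at ht
        linarith
      calc Real.exp (δ / 2 * t) * 2 ≤ Real.exp (δ / 2 * t) * Real.exp (δ / 4 * t) :=
            mul_le_mul_of_nonneg_left h3 (Real.exp_pos _).le
        _ = Real.exp (δ * t + -(δ / 4 * t)) := by rw [← Real.exp_add]; congr 1; ring
  -- For `ε > 1` the core is everything: no descent is needed and the walk cannot leak.
  · refine ⟨0, fun t => Set.univ, fun t _ => Set.univ, Eventually.of_forall fun t => ?_⟩
    rw [core_eq_univ hπ hε]
    refine ⟨subset_rfl, subset_rfl, fun _ => subset_rfl, subset_rfl, by simp, fun u _ B hB => ?_⟩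
    have : B = Finset.univ := Finset.eq_univ_of_forall fun v => hB v trivial
    rw [this, (h.kronPow t).row_sum]
    linarith

end Levels

/-- With `z = e^(δt/2)` the exponent is `-γz²`. The prefactor costs `O(z)` in the exponent, so `-z`
survives as soon as `γz ≥ C`. -/
theorem eventually_union_bound (A : ℝ) (k : ℕ) {γ δ : ℝ} (hA : 0 ≤ A) (hγ : 0 < γ) (hδ : 0 < δ) :
    ∀ᶠ t : ℕ in atTop, A * ((k : ℝ) ^ t * Real.exp (-(γ * Real.exp (δ * t)))) ≤
      Real.exp (-(1 * Real.exp (δ / 2) ^ t)) := by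
  set C := A + 2 * k / δ + 1 with hC
  have hC0 : 0 < C := by positivity
  filter_upwards [tendsto_natCast_atTop_atTop.eventually_ge_atTop (2 / δ * (C / γ))] with t ht
  set z := Real.exp (δ / 2 * t) with hz
  have hz2 : Real.exp (δ * t) = z * z := by rw [hz, ← Real.exp_add]; congr 1; ring
  have hzt : Real.exp (δ / 2) ^ t = z := by rw [← Real.exp_nat_mul, hz]; congr 1; ring
  have hz1 := Real.add_one_le_exp (δ / 2 * t)
  rw [← hz] at hz1
  have hδt : 0 ≤ δ / 2 * t := by positivity
  have hk : (k : ℝ) ^ t ≤ Real.exp (k * t) := by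
    rw [mul_comm, Real.exp_nat_mul]
    exact pow_le_pow_left₀ (Nat.cast_nonneg k) (by linarith [Real.add_one_le_exp (k : ℝ)]) t
  have hAe : A ≤ Real.exp A := by linarith [Real.add_one_le_exp A]
  rw [hz2, hzt]
  calc A * ((k : ℝ) ^ t * Real.exp (-(γ * (z * z))))
      ≤ Real.exp A * (Real.exp (k * t) * Real.exp (-(γ * (z * z)))) := by gcongr
    _ = Real.exp (A + (k * t + -(γ * (z * z)))) := by rw [Real.exp_add, Real.exp_add]
    _ ≤ Real.exp (-(1 * z)) := by
      refine Real.exp_le_exp.2 ?_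
      have h1 : C / γ ≤ z := by
        have : δ / 2 * (2 / δ * (C / γ)) ≤ δ / 2 * t :=
          mul_le_mul_of_nonneg_left ht (by positivity)
        have e : δ / 2 * (2 / δ * (C / γ)) = C / γ := by field_simp
        linarith
      rw [div_le_iff₀ hγ] at h1
      have h2 : C * z ≤ z * γ * z := mul_le_mul_of_nonneg_right h1 (by linarith)
      have h3 : (k : ℝ) * t ≤ 2 * k / δ * z := by
        have : 2 * k / δ * (δ / 2 * t) ≤ 2 * k / δ * z :=
          mul_le_mul_of_nonneg_left (by linarith) (by positivity)
        have e : 2 * k / δ * (δ / 2 * t) = (k : ℝ) * t := by field_simp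
        linarith
      have h4 : A * 1 ≤ A * z := mul_le_mul_of_nonneg_left (by linarith) hA
      rw [hC] at h2
      linarith

/-! ### Assembly -/

section Main

variable {k : ℕ} {P : Matrix (Fin k) (Fin k) ℝ}

/-- A single vertex has `c = P i i ≤ 1`, so `c ln c ≤ 0`. Two vertices are what makes every `π i <
1`. -/
theorem nontrivial_of_sumDegLogDeg_pos (h01 : ∀ i j, P i j ∈ Set.Icc (0 : ℝ) 1)
    (hpos : 0 < sumDegLogDeg P) : Nontrivial (Fin k) := by
  by_contra hcon
  rw [not_nontrivial_iff_subsingleton] at hcon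
  refine hpos.not_ge (Finset.sum_nonpos fun i _ => ?_)
  have : colSum P i = P i i := by
    rw [colSum, Finset.sum_eq_single i (fun j _ hj => (hj (Subsingleton.elim j i)).elim) (by simp)]
  rw [this]
  exact mul_nonpos_of_nonneg_of_nonpos (h01 i i).1 (Real.log_nonpos (h01 i i).1 (h01 i i).2)

theorem colSum_div_vol_lt_one [Nontrivial (Fin k)] (hc : ∀ i, 0 < colSum P i) (i : Fin k) :
    colSum P i / vol P < 1 := by
  have hv : 0 < vol P := Finset.sum_pos (fun i _ => hc i) Finset.univ_nonempty
  rw [div_lt_one hv]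
  obtain ⟨j, hj⟩ := exists_ne i
  exact Finset.single_lt_sum hj (Finset.mem_univ i) (Finset.mem_univ j) (hc j)
    fun l _ _ => (hc l).le

/-- Each word weighs at least `p^t`, so growth by `1 + γ` passes one half within `R t` rounds, with
`R` independent of `t`. -/
theorem exists_pow_mul_wordWeight_gt {π : Fin k → ℝ} (hπ : ∀ i, 0 < π i) {γ : ℝ} (hγ : 0 < γ) :
    ∃ R : ℕ, ∀ t, ∀ v : Fin t → Fin k, 1 / 2 < (1 + γ) ^ (R * t) * wordWeight π t v := by
  obtain ⟨p, hp, hpπ⟩ := exists_pos_le hπ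
  obtain ⟨R, hR⟩ := pow_unbounded_of_one_lt (1 / p) (by linarith : 1 < 1 + γ)
  refine ⟨R, fun t v => ?_⟩
  have h1 : p ^ t ≤ wordWeight π t v := by
    calc p ^ t = ∏ _s : Fin t, p := by simp
      _ ≤ _ := Finset.prod_le_prod (fun _ _ => hp.le) fun s _ => hpπ (v s)
  have h2 : 1 ≤ (1 + γ) ^ R * p := by
    rw [div_lt_iff₀ hp] at hR
    exact hR.le
  calc (1 : ℝ) / 2 < 1 := by norm_num
    _ ≤ ((1 + γ) ^ R * p) ^ t := one_le_pow₀ h2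
    _ = (1 + γ) ^ (R * t) * p ^ t := by rw [mul_pow, pow_mul]
    _ ≤ _ := mul_le_mul_of_nonneg_left h1 (by positivity)

theorem graphOf_adj {V : Type} {ω : Sym2 V → Bool} {u v : V} :
    (graphOf ω).Adj u v ↔ ω s(u, v) = true ∧ u ≠ v := by
  simp [graphOf]

/-- The probability that the induced graph is connected with small diameter, in terms of lower
bounds for the expected numbers of edges between levels and out of small sets. -/
theorem law_connected_diam_ge (hP : P.IsSymm) (h01 : ∀ i j, P i j ∈ Set.Icc (0 : ℝ) 1) {t : ℕ}
    {C : Set (Fin t → Fin k)} {D : Finset (Fin t → Fin k)} {L : ℕ → Finset (Fin t → Fin k)}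
    {m r : ℕ} {μ : (Fin t → Fin k) → ℝ} {γ y : ℝ} (hμ : ∀ v, 0 ≤ μ v) (hμ1 : ∑ v, μ v = 1)
    (hγ : 0 ≤ γ) (hDC : ∀ v ∈ D, v ∈ C) (hr : ∀ v ∈ D, 1 / 2 < (1 + γ) ^ r * μ v)
    (hne : C.Nonempty) (hL0 : ∀ v ∈ C, v ∈ L 0) (hLC : ∀ j, ∀ v ∈ L j, v ∈ C) (hLD : L m ⊆ D)
    (hstep : ∀ j < m, ∀ u ∈ L j, y ≤ ∑ v ∈ L (j + 1), kronPow P t u v)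
    (hexp : ∀ S T : Finset (Fin t → Fin k), S ⊆ T → T ⊆ D → S.Nonempty → ∑ v ∈ S, μ v ≤ 1 / 2 →
      ∑ v ∈ T, μ v ≤ (1 + γ) * ∑ v ∈ S, μ v →
        y * T.card ≤ ∑ u ∈ S, ∑ v ∈ D.filter (· ∉ T), kronPow P t u v)
    (hy : 2 * ((k : ℝ) ^ t * Real.exp (-y)) ≤ 1) :
    1 - (3 * m + 4) * ((k : ℝ) ^ t * Real.exp (-y)) ≤ (law P hP h01 t).real
      {ω | ((graphOf ω).induce C).Connected ∧ ((graphOf ω).induce C).diam ≤ 2 * m + 2 * r} := by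
  set A : Finset (Fin t → Fin k) → Finset (Fin t → Fin k) → Prop := fun S T =>
    S ⊆ T ∧ T ⊆ D ∧ S.Nonempty ∧ ∑ v ∈ S, μ v ≤ 1 / 2 ∧
      ∑ v ∈ T, μ v ≤ (1 + γ) * ∑ v ∈ S, μ v with hA
  set good := {ω : Sym2 (Fin t → Fin k) → Bool | ((graphOf ω).induce C).Connected ∧
    ((graphOf ω).induce C).diam ≤ 2 * m + 2 * r} with hgood
  set bad₁ := fun j => {ω : Sym2 (Fin t → Fin k) → Bool |
    ∃ u ∈ L j, ∀ v ∈ L (j + 1), v ≠ u → ω s(u, v) = false} with hbad₁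
  set bad₂ := {ω : Sym2 (Fin t → Fin k) → Bool |
    ∃ S T, A S T ∧ ∀ u ∈ S, ∀ v ∈ D.filter (· ∉ T), ω s(u, v) = false} with hbad₂
  have hcover : (Set.univ : Set (Sym2 (Fin t → Fin k) → Bool)) ⊆
      good ∪ ((⋃ j ∈ Finset.range m, bad₁ j) ∪ bad₂) := by
    intro ω _
    by_contra hcon
    simp only [Set.mem_union, not_or] at hcon
    obtain ⟨hg, h1, h2⟩ := hcon
    refine hg (connected_and_diam_le (D := D) hμ hμ1 hγ hDC ?_ hr hne hL0 hLC hLD ?_)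
    · intro S T hST hTD hS hS2 hT
      by_contra hno
      refine h2 ⟨S, T, ⟨hST, hTD, hS, hS2, hT⟩, fun u hu v hv => ?_⟩
      obtain ⟨hvD, hvT⟩ := Finset.mem_filter.1 hv
      by_contra hω
      refine hno ⟨u, hu, v, hvD, hvT, graphOf_adj.2 ⟨Bool.eq_true_of_not_eq_false hω, ?_⟩⟩
      rintro rfl
      exact hvT (hST hu)
    · intro j hj u hu
      by_contra hno
      refine h1 (Set.mem_biUnion (x := j) (Finset.mem_coe.2 (Finset.mem_range.2 hj))
        ⟨u, hu, fun v hv hne => ?_⟩)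
      by_contra hω
      exact hno ⟨v, hv, graphOf_adj.2 ⟨Bool.eq_true_of_not_eq_false hω, hne.symm⟩⟩
  have hb₁ : (law P hP h01 t).real (⋃ j ∈ Finset.range m, bad₁ j) ≤
      m * ((k : ℝ) ^ t * Real.exp (1 - y)) := by
    refine (measureReal_biUnion_finset_le _ _).trans ?_
    refine (Finset.sum_le_card_nsmul _ _ _ fun j hj =>
      law_no_neighbour_le hP h01 (L j) (L (j + 1)) (hstep j (Finset.mem_range.1 hj))).trans ?_
    rw [nsmul_eq_mul, Finset.card_range]
  have hb₂ : (law P hP h01 t).real bad₂ ≤ 4 * ((k : ℝ) ^ t * Real.exp (-y)) := by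
    refine law_no_expansion_le hP h01 D A ?_ (by linarith)
    rintro S T ⟨h1, h2, h3, h4, h5⟩
    exact ⟨h1, h3.mono h1, hexp S T h1 h2 h3 h4 h5⟩
  have huniv : (1 : ℝ) ≤ (law P hP h01 t).real good +
      ((law P hP h01 t).real (⋃ j ∈ Finset.range m, bad₁ j) + (law P hP h01 t).real bad₂) := by
    calc (1 : ℝ) = (law P hP h01 t).real Set.univ := by simp
      _ ≤ (law P hP h01 t).real (good ∪ ((⋃ j ∈ Finset.range m, bad₁ j) ∪ bad₂)) :=
        measureReal_mono hcover (measure_ne_top _ _)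
      _ ≤ _ := (measureReal_union_le _ _).trans (add_le_add_right (measureReal_union_le _ _) _)
  -- The bound `e < 3` on the loop correction accounts for the `3m` in `3m + 4`.
  have he : Real.exp (1 - y) ≤ 3 * Real.exp (-y) := by
    rw [sub_eq_add_neg, Real.exp_add]
    exact mul_le_mul_of_nonneg_right Real.exp_one_lt_three.le (Real.exp_pos _).le
  have hm : (m : ℝ) * ((k : ℝ) ^ t * Real.exp (1 - y)) ≤
      m * ((k : ℝ) ^ t * (3 * Real.exp (-y))) := by gcongr
  linarith

end Main

end Kronecker

theorem theoremT (k : ℕ) (P : Matrix (Fin k) (Fin k) ℝ) (hP : P.IsSymm)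
    (h01 : ∀ i j, P i j ∈ Set.Icc (0 : ℝ) 1)
    (hconn : Kronecker.WConnected P) (hbip : ¬ Kronecker.WBipartite P)
    (hpos : 0 < Kronecker.sumDegLogDeg P)
    (π : Fin k → ℝ) (hπ : Kronecker.IsStationary (Kronecker.walkMatrix P) π)
    (ε : ℝ) (hε0 : 0 < ε) (hε1 : ε ≠ 1)
    (hε : Kronecker.sumDegLogDeg P ≠ Kronecker.vol P * Real.log (Kronecker.minColSum P) →
      ε < Kronecker.sumDegLogDeg P /
        (Kronecker.sumDegLogDeg P - Kronecker.vol P * Real.log (Kronecker.minColSum P))) :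
    ∃ d > (1 : ℝ), ∃ a > (0 : ℝ), ∃ K > (0 : ℝ), ∀ᶠ t : ℕ in atTop,
      1 - Real.exp (-(a * d ^ t)) ≤
        (Kronecker.law P hP h01 t).real
          {ω | ((Kronecker.graphOf ω).induce (Kronecker.core π ε t)).Connected ∧
            (((Kronecker.graphOf ω).induce (Kronecker.core π ε t)).diam : ℝ) ≤
              K * Real.log (Nat.card (Kronecker.core π ε t))} := by
  classical
  have h0 : ∀ i j, 0 ≤ P i j := fun i j => (h01 i j).1
  rw [hπ.eq_colSum_div_vol h0 hP hconn hbip]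
  have hc := Kronecker.colSum_pos h0 hP hconn hbip
  have := Kronecker.nontrivial_of_sumDegLogDeg_pos h01 hpos
  have hv : 0 < Kronecker.vol P := Finset.sum_pos (fun i _ => hc i) Finset.univ_nonempty
  have hrev := Kronecker.isReversible_walkMatrix h0 hP hc
  obtain ⟨lam, hl0, hl1, hg⟩ := Kronecker.exists_gap_walkMatrix h0 hP hconn hbip
  obtain ⟨δ, hδ, hdeg⟩ := Kronecker.exists_exp_le_wordWeight hc hpos hε
  set π₀ : Fin k → ℝ := fun i => Kronecker.colSum P i / Kronecker.vol P with hπ₀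
  have hπpos : ∀ i, 0 < π₀ i := fun i => div_pos (hc i) hv
  set γ := (1 - lam) / 16 with hγ
  have hγ0 : 0 < γ := by rw [hγ]; linarith
  have hγ1 : γ ≤ 1 := by rw [hγ]; linarith
  obtain ⟨m, D, L, hlev⟩ := Kronecker.exists_levels hc hrev hl0 hl1 hg hε0 hε1 hδ hdeg hγ0
  obtain ⟨R, hR⟩ := Kronecker.exists_pow_mul_wordWeight_gt hπpos hγ0
  obtain ⟨c, hc0, hcard⟩ := Kronecker.eventually_log_card_core hπpos
    (Kronecker.colSum_div_vol_lt_one hc) hrev.sum_eq_one hε0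
  have hδ2 : 0 < δ / 2 := by linarith
  -- The level steps keep the exponent `δ/2`, and the union bound halves it again. In `K`, the
  -- diameter `2m + 2Rt` is at most `(2m + 2R + 1) t`, and `t ≤ ln |S_ε| / c`; the `+ 1` keeps `K`
  -- positive.
  refine ⟨Real.exp (δ / 2 / 2), Real.one_lt_exp_iff.2 (by linarith), 1, one_pos,
    (2 * m + 2 * R + 1) / c, by positivity, ?_⟩
  filter_upwards [hlev, hcard, eventually_gt_atTop 0,
    Kronecker.eventually_union_bound (3 * m + 4) k (by positivity) hγ0 hδ2,
    Kronecker.eventually_union_bound 2 k (by norm_num) hγ0 hδ2]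
    with t ⟨hDC, hCL, hLC, hLD, hstep, hstay⟩ ⟨hne, hlog⟩ ht hub hub2
  have htr : (1 : ℝ) ≤ t := by exact_mod_cast ht
  set y := γ * Real.exp (δ / 2 * t) with hy
  have hrevt := hrev.kronPow t
  have key := Kronecker.law_connected_diam_ge hP h01 (C := Kronecker.core π₀ ε t)
    (D := (D t).toFinset) (L := fun j => (L t j).toFinset) (m := m) (r := R * t)
    (μ := Kronecker.wordWeight π₀ t) (γ := γ) (y := y) hrevt.nonneg hrevt.sum_eq_one hγ0.le
    (fun v hv => hDC (Set.mem_toFinset.1 hv)) (fun v _ => hR t v) hne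
    (fun v hv => Set.mem_toFinset.2 (hCL hv)) (fun j v hv => hLC j (Set.mem_toFinset.1 hv))
    (Set.toFinset_subset_toFinset.2 hLD) ?_ ?_ ?_
  · refine le_trans (sub_le_sub_left hub 1) (key.trans ?_)
    refine measureReal_mono (fun ω hω => ⟨hω.1, ?_⟩) (measure_ne_top _ _)
    have h1 : (((Kronecker.graphOf ω).induce (Kronecker.core π₀ ε t)).diam : ℝ) ≤
        2 * m + 2 * (R * t) := by exact_mod_cast hω.2
    have h2 : (2 * (m : ℝ) + 2 * R + 1) / c * (c * t) ≤ (2 * m + 2 * R + 1) / c *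
        Real.log (Nat.card (Kronecker.core π₀ ε t)) :=
      mul_le_mul_of_nonneg_left hlog (by positivity)
    have h3 : (2 * (m : ℝ) + 2 * R + 1) / c * (c * t) = (2 * m + 2 * R + 1) * t := by
      field_simp
    have h4 : (m : ℝ) * 1 ≤ m * t := mul_le_mul_of_nonneg_left htr (Nat.cast_nonneg m)
    linarith
  · intro j hj u hu
    refine le_trans ?_ (hstep j hj u (Set.mem_toFinset.1 hu) _ fun v hv => Set.mem_toFinset.2 hv)
    exact mul_le_of_le_one_left (Real.exp_pos _).le hγ1
  · intro S T hST hTD hS hS2 hT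
    have hflow := hrevt.expansion (hg.kronPow hrev hl0 t) hl0 hl1
      (fun u hu => hstay u (Set.mem_toFinset.1 hu) _ fun v hv => Set.mem_toFinset.2 hv)
      hST hTD hS2 hT
    have hw : ∀ u, Kronecker.wordWeight (Kronecker.colSum P) t u =
        Kronecker.vol P ^ t * Kronecker.wordWeight π₀ t u :=
      Kronecker.wordWeight_colSum hv.ne' t
    have hvt : 0 ≤ Kronecker.vol P ^ t := by positivity
    -- Degrees are `vol^t` times stationary weights, so the degree bound on `T` and the flow out of
    -- `S` combine into a count of expected edges proportional to `|T|`.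
    calc y * T.card = γ * ∑ _v ∈ T, Real.exp (δ / 2 * t) := by
          rw [Finset.sum_const, nsmul_eq_mul, hy]; ring
      _ ≤ γ * ∑ v ∈ T, Kronecker.wordWeight (Kronecker.colSum P) t v := by
          refine mul_le_mul_of_nonneg_left (Finset.sum_le_sum fun v hv => ?_) hγ0.le
          refine le_trans (Real.exp_le_exp.2 ?_)
            (hdeg t ht v (hDC (Set.mem_toFinset.1 (hTD hv))))
          exact mul_le_mul_of_nonneg_right (by linarith) (by linarith)
      _ = Kronecker.vol P ^ t * (γ * ∑ v ∈ T, Kronecker.wordWeight π₀ t v) := by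
          simp_rw [hw, ← Finset.mul_sum]; ring
      _ ≤ Kronecker.vol P ^ t * ∑ u ∈ S, ∑ v ∈ (D t).toFinset.filter (· ∉ T),
            Kronecker.wordWeight π₀ t u * Kronecker.kronPow (Kronecker.walkMatrix P) t u v :=
          mul_le_mul_of_nonneg_left hflow hvt
      _ = _ := by
          simp_rw [Kronecker.kronPow_eq_mul_walk hc, hw, Finset.mul_sum, mul_assoc]
  · exact hub2.trans (Real.exp_le_one_iff.2 (by
      have := Real.exp_pos (δ / 2 / 2)
      simp only [one_mul, Left.neg_nonpos_iff]
      positivity))
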